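/- **Network.** There are $K$ data flows (one per single-antenna user) and $J$ radio units, unit $j$ having $M_j$ antennas and power budget $P_j>0$. Time consists of slots $n=0,1,2,\dots$ of length $\tau>0$; slot $n$ lies in frame $t(n)=\lfloor n/T_f\rfloor$, $T_f\ge 1$. The channels $H[n]=(h_{k}^{j}[n])$, $h_k^j[n]\in\mathbb C^{M_j}$, are i.i.d. over slots with an arbitrary law. The arrival rates $A_k[t]\in[0,A^{\max}]$, with $\mathbb E A_k[t]=\bar A_k$, form a process over the frames $t$ with an arbitrary law, independent of the channels. For beamformers $w=(w_k^j)$, $w_k^j\in\mathbb C^{M_j}$, put $$r_k^j(H,w)=W\log_2\Bigl(1+\tfrac{|(h_k^j)^{\mathsf H}w_k^j|^2}{\sum_{j'\ne j}|(h_k^{j'})^{\mathsf H}w_k^{j'}|^2+\sum_{k'\ne k}\sum_{j'}|(h_k^{j'})^{\mathsf H}w_{k'}^{j'}|^2+N_0}\Bigr),\qquad r_k=\sum_j r_k^j ,$$ and let $\mathcal W=\{w:\sum_k\|w_k^j\|_2^2\le P_j\ \forall j\}$. **Policies.** A policy chooses causally (possibly with randomization independent of channels and arrivals) flow splits $\beta_k^j[t]\in[0,1]$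 with $\sum_j\beta_k^j[t]=1$ (at the beginning of frame $t$), congestion control rates $a_k[n]\in[0,A^{\max}]$, and beamformers $w[n]\in\mathcal W$ (knowing $H[n]$). The queues start at $0$ and evolve by $$q_k^{j}[n+1]=\bigl[q_k^j[n]+\beta_k^j[t(n)]A_k[t(n)]\tau-r_k^j(H[n],w[n])\tau\bigr]^+,\qquad \hat q_k[n+1]=\bigl[\hat q_k[n]+a_k[n]\tau-r_k(H[n],w[n])\tau\bigr]^+ .$$ A beamformer $v$ satisfies the delay constraint of slot $n$ if for all $k,j$ $$\sum_{\ell\le t(n)}\beta_k^j[\ell]\bar A_k\tau-(1-\epsilon_k)\bar A_k\bar d_k-\sum_{m<n}r_k^j(H[m],w[m])\tau\le r_k^j(H[n],v)\tau ,$$ where $\epsilon_k\in(0,1]$ and $\bar d_k\ge 0$ are given. A policy is feasible with average rates $\bar a\in\mathbb R^K$ if $\bar a_k=\lim_T\frac1T\sum_{n<T}\mathbb E a_k[n]$, $\limsup_n\mathbb E\|q[n]\|_1<\infty$, the delay constraint holds almost surely in every slot, and $\bar a_k\le\bar r_k:=\liminf_T\frac1T\sum_{n<T}\mathbb E\, r_k(H[n],w[n])$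 for all $k$. Let $a^*$ maximize $U(\bar a)=\sum_kU_k(\bar a_k)$ over all $\bar a$ attained by feasible policies, and let $\bar r^{\max}$ be the supremum of $\bar r_k$ over all $k$ and all feasible policies. **Assumptions.** Each $U_k$ is twice continuously differentiable, increasing and strictly concave on $[0,\infty)$, and $0<\psi\le -U_k''(x)\le\Psi$ for $x\in[0,\bar r^{\max}]$. Almost surely $r_k(H[n],w)\le r^{\max}$ for all $k$ and all $w\in\mathcal W$, where $r^{\max}>0$ is a constant. **Algorithm.** Let $\varphi>0$. In a run of the algorithm the policy uses $$a_k[n]=\min\bigl\{U_k'^{-1}\bigl(\hat q_k[n]/(\varphi\tau)\bigr),A^{\max}\bigr\}$$ (with $U_k'^{-1}(y)=0$ for $y>U_k'(0)$, and $a_k[n]=A^{\max}$ if $\hat q_k[n]/(\varphi\tau)\le U_k'(A^{\max})$), and $w[n]$ almost surely maximizes $\sum_k\frac{\hat q_k[n]}{\tau}r_k(H[n],w)$ over the $w\in\mathcal W$ that satisfy the delay constraint of slot $n$; the flow splits may be chosen by any causal rule. Suppose that $\mathbb E\,a_k[n]^2\le A_1^{\max}$ for all $k,n$, that $\limsup_n\mathbb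 E\|q[n]\|_1<\infty$, that in the long run the delay constraint is not binding for the scheduler (the expected fraction of slots among the first $T$ in which $w[n]$ does not maximize the weighted sum rate over all of $\mathcal W$ tends to $0$ as $T\to\infty$), and that $\hat q$ has a steady state $\hat q^\infty_\varphi$ (the time averages of the laws of $\hat q[n]$ converge weakly to the law of $\hat q^\infty_\varphi$). Let $a^\infty_{\varphi,k}=\mathbb E\min\{U_k'^{-1}(\hat q^\infty_{\varphi,k}/(\varphi\tau)),A^{\max}\}$, with the same conventions. **Theorem (Optimality).** With $C_1=\sqrt{\tfrac{K\tau^2\Psi}{2}\bigl(A_1^{\max}+(r^{\max})^2\bigr)}$, $$\|a^\infty_\varphi-a^*\|_2\le \frac{C_2}{\sqrt\varphi},\qquad C_2=\frac{C_1}{\psi\tau},$$ and $$U(a^*)-\frac{C_3}{\varphi}\le U(a^\infty_\varphi),\qquad C_3=\frac{\Psi C_1^2}{2\psi^2\tau^2}.$$ -/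

import Mathlib

open MeasureTheory Filter Topology

noncomputable section

/-- Channel realizations in one slot: the vector `h k j` from radio unit `j` (with `M j` antennas)
to user `k`. The radio units of all distributed units are numbered `0, …, J - 1`. -/
abbrev Channel (K J : ℕ) (M : Fin J → ℕ) : Type :=
  (_ : Fin K) → (j : Fin J) → EuclideanSpace ℂ (Fin (M j))

/-- Beamformers in one slot: the vector `w k j` sent by radio unit `j` to user `k`. -/
abbrev Beam (K J : ℕ) (M : Fin J → ℕ) : Type :=
  (_ : Fin K) → (j : Fin J) → EuclideanSpace ℂ (Fin (M j))

/-- The data of the downlink network with `K` data flows (users) and `J` radio units.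
Slots are numbered `n = 0, 1, 2, …`, and slot `n` belongs to frame `n / Tf`. -/
structure Network (K J : ℕ) where
  /-- number of antennas of each radio unit -/
  M : Fin J → ℕ
  /-- bandwidth -/
  W : ℝ
  /-- noise power -/
  N₀ : ℝ
  /-- power budgets -/
  Pmax : Fin J → ℝ
  /-- slot duration -/
  τ : ℝ
  /-- number of slots per frame -/
  Tf : ℕ
  /-- upper bound on arrivals and on the congestion control rates -/
  Amax : ℝ
  /-- mean arrival rates -/
  Abar : Fin K → ℝ
  /-- maximum allowable average delays -/
  dbar : Fin K → ℝ
  /-- required reliabilities -/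
  eps : Fin K → ℝ
  /-- law of the channel in one slot -/
  chan : Measure (Channel K J M)
  /-- law of the arrival process, indexed by frames -/
  arr : Measure (ℕ → Fin K → ℝ)
  W_pos : 0 < W
  N₀_pos : 0 < N₀
  Pmax_pos : ∀ j, 0 < Pmax j
  τ_pos : 0 < τ
  Tf_pos : 0 < Tf
  Amax_pos : 0 < Amax
  dbar_nonneg : ∀ k, 0 ≤ dbar k
  eps_mem : ∀ k, eps k ∈ Set.Ioc (0 : ℝ) 1
  chan_prob : IsProbabilityMeasure chan
  arr_prob : IsProbabilityMeasure arr
  arr_mem : ∀ᵐ A ∂arr, ∀ t k, A t k ∈ Set.Icc (0 : ℝ) Amax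
  arr_mean : ∀ t k, ∫ A, A t k ∂arr = Abar k

namespace Network

variable {K J : ℕ} (N : Network K J)

/-! ### Rates -/

/-- Interference plus noise seen by user `k` on the path through radio unit `j`. -/
def interference (h : Channel K J N.M) (w : Beam K J N.M) (k : Fin K) (j : Fin J) : ℝ :=
  (∑ j' ∈ Finset.univ.erase j, ‖inner ℂ (h k j') (w k j')‖ ^ 2)
    + (∑ k' ∈ Finset.univ.erase k, ∑ j', ‖inner ℂ (h k j') (w k' j')‖ ^ 2) + N.N₀

/-- Signal-to-interference-plus-noise ratio. -/
def sinr (h : Channel K J N.M) (w : Beam K J N.M) (k : Fin K) (j : Fin J) : ℝ :=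
  ‖inner ℂ (h k j) (w k j)‖ ^ 2 / N.interference h w k j

/-- Achievable rate of user `k` from radio unit `j`. -/
def pathRate (h : Channel K J N.M) (w : Beam K J N.M) (k : Fin K) (j : Fin J) : ℝ :=
  N.W * Real.logb 2 (1 + N.sinr h w k j)

/-- Overall rate of user `k`. -/
def rate (h : Channel K J N.M) (w : Beam K J N.M) (k : Fin K) : ℝ :=
  ∑ j, N.pathRate h w k j

/-- Beamformers within the power budgets. The instantaneous achievable rate region for the channel
`h` is the image of this set under `N.rate h`. -/
def powerSet : Set (Beam K J N.M) :=
  {w | ∀ j, ∑ k, ‖w k j‖ ^ 2 ≤ N.Pmax j}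

/-! ### The probability space -/

/-- A sample: a random seed (for randomized decisions), the channels of all slots, and the arrival
rates of all frames. -/
abbrev Sample (S : Type) : Type := S × (ℕ → Channel K J N.M) × (ℕ → Fin K → ℝ)

/-- Channels are i.i.d. over slots; seed, channels and arrivals are independent. -/
def prob {S : Type} [MeasurableSpace S] (σ : Measure S) : Measure (N.Sample S) :=
  haveI := N.chan_prob
  haveI := N.arr_prob
  σ.prod ((Measure.infinitePi fun _ : ℕ => N.chan).prod N.arr)

/-- Information available before the channel of slot `n` is revealed: the seed, the channels of the
earlier slots, and the arrivals of the frames that began before slot `n`. -/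
@[reducible] def info (S : Type) [MeasurableSpace S] (n : ℕ) : MeasurableSpace (N.Sample S) :=
  MeasurableSpace.comap (fun ω : N.Sample S => ω.1) inferInstance
    ⊔ (⨆ (m : ℕ) (_ : m < n),
        MeasurableSpace.comap (fun ω : N.Sample S => ω.2.1 m) inferInstance)
    ⊔ (⨆ (t : ℕ) (_ : t * N.Tf < n),
        MeasurableSpace.comap (fun ω : N.Sample S => ω.2.2 t) inferInstance)

/-! ### Policies -/

/-- A causal policy: flow splits per frame, congestion control rates and beamformers per slot. -/
structure Policy (S : Type) [MeasurableSpace S] where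
  /-- fraction of flow `k` routed through radio unit `j` in frame `t` -/
  β : ℕ → N.Sample S → Fin K → Fin J → ℝ
  /-- congestion control rates in slot `n` -/
  a : ℕ → N.Sample S → Fin K → ℝ
  /-- beamformers in slot `n` -/
  w : ℕ → N.Sample S → Beam K J N.M
  β_meas : ∀ t, Measurable[N.info S (t * N.Tf)] (β t)
  a_meas : ∀ n, Measurable[N.info S (n + 1)] (a n)
  w_meas : ∀ n, Measurable[N.info S (n + 1)] (w n)
  β_mem : ∀ t ω k j, β t ω k j ∈ Set.Icc (0 : ℝ) 1
  β_sum : ∀ t ω k, ∑ j, β t ω k j = 1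
  a_mem : ∀ n ω k, a n ω k ∈ Set.Icc (0 : ℝ) N.Amax
  w_mem : ∀ n ω, w n ω ∈ N.powerSet

namespace Policy

variable {N} {S : Type} [MeasurableSpace S] (p : N.Policy S)

/-- Rate of user `k` in slot `n`. -/
def r (n : ℕ) (ω : N.Sample S) (k : Fin K) : ℝ :=
  N.rate (ω.2.1 n) (p.w n ω) k

/-- Queue of flow `k` at radio unit `j`, initially empty. -/
def queue : ℕ → N.Sample S → Fin K → Fin J → ℝ
  | 0, _, _, _ => 0
  | n + 1, ω, k, j =>
      max 0 (queue n ω k j + p.β (n / N.Tf) ω k j * ω.2.2 (n / N.Tf) k * N.τ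
        - N.pathRate (ω.2.1 n) (p.w n ω) k j * N.τ)

/-- Auxiliary queue of flow `k`, initially empty. -/
def auxQueue : ℕ → N.Sample S → Fin K → ℝ
  | 0, _, _ => 0
  | n + 1, ω, k => max 0 (auxQueue n ω k + p.a n ω k * N.τ - p.r n ω k * N.τ)

/-- The delay constraint of slot `n`, as a constraint on a candidate beamformer `v` for that slot,
given the flow splits and the beamformers that the policy used before. -/
def DelayOK (n : ℕ) (ω : N.Sample S) (v : Beam K J N.M) : Prop :=
  ∀ k j,
    (∑ t ∈ Finset.range (n / N.Tf + 1), p.β t ω k j * N.Abar k * N.τ)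
      - (1 - N.eps k) * N.Abar k * N.dbar k
      - (∑ m ∈ Finset.range n, N.pathRate (ω.2.1 m) (p.w m ω) k j * N.τ)
    ≤ N.pathRate (ω.2.1 n) v k j * N.τ

/-- Stability of the queueing network: `limsup E ‖q[n]‖₁ < ∞`. -/
def Stable (σ : Measure S) : Prop :=
  limsup (fun n => ∫⁻ ω, ENNReal.ofReal (∑ k, ∑ j, p.queue n ω k j) ∂(N.prob σ)) atTop < ⊤

/-- Long-term average service rate of flow `k`. -/
def avgRate (σ : Measure S) (k : Fin K) : ℝ :=
  liminf (fun T : ℕ => (∑ n ∈ Finset.range T, ∫ ω, p.r n ω k ∂(N.prob σ)) / T) atTop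

/-- The policy is feasible for the network utility maximization problem and has the long-term
average congestion control rates `abar`. (Power budgets, flow-split simplices and the range of the
congestion control rates are part of `Policy`.) -/
structure Feasible (σ : Measure S) (abar : Fin K → ℝ) : Prop where
  avg : ∀ k, Tendsto
    (fun T : ℕ => (∑ n ∈ Finset.range T, ∫ ω, p.a n ω k ∂(N.prob σ)) / T) atTop (𝓝 (abar k))
  stable : p.Stable σ
  delay : ∀ n, ∀ᵐ ω ∂(N.prob σ), p.DelayOK n ω (p.w n ω)
  le_rate : ∀ k, abar k ≤ p.avgRate σ k

end Policy

/-- The long-term average congestion control rate vectors of all feasible policies. -/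
def feasibleRates : Set (Fin K → ℝ) :=
  {abar | ∃ (S : Type) (_ : MeasurableSpace S) (σ : Measure S) (_ : IsProbabilityMeasure σ)
    (p : N.Policy S), p.Feasible σ abar}

/-- The maximum long-term average rate of any data flow, over all feasible policies. -/
def maxAvgRate : ℝ :=
  sSup {x | ∃ (S : Type) (_ : MeasurableSpace S) (σ : Measure S) (_ : IsProbabilityMeasure σ)
    (p : N.Policy S) (abar : Fin K → ℝ) (k : Fin K), p.Feasible σ abar ∧ x = p.avgRate σ k}

end Network

/-! ### Utilities -/

/-- First derivative of a utility function on `[0, ∞)`. -/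
def marginal (U : ℝ → ℝ) : ℝ → ℝ := derivWithin U (Set.Ici 0)

/-- Total utility. -/
def totalUtility {K : ℕ} (U : Fin K → ℝ → ℝ) (a : Fin K → ℝ) : ℝ := ∑ k, U k (a k)

/-- Conditions on a utility function, with curvature bounds `ψ`, `Ψ` on `[0, rbar]`. -/
structure UtilityOK (U : ℝ → ℝ) (ψ Ψ rbar : ℝ) : Prop where
  contDiff : ContDiffOn ℝ 2 U (Set.Ici 0)
  increasing : StrictMonoOn U (Set.Ici 0)
  concave : StrictConcaveOn ℝ (Set.Ici 0) U
  curvature : ∀ x ∈ Set.Icc 0 rbar,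
    ψ ≤ -derivWithin (marginal U) (Set.Ici 0) x ∧ -derivWithin (marginal U) (Set.Ici 0) x ≤ Ψ

/-- The rate `min {U'⁻¹(y), Amax}` in `[0, Amax]`: it equals `x` if `U' x = y` with
`x ∈ [0, Amax]`, it equals `Amax` if `y ≤ U' Amax`, and it equals `0` if `U' 0 < y` (the supremum
of the empty set is `0`). -/
def congestionRate (U : ℝ → ℝ) (Amax y : ℝ) : ℝ :=
  sSup {x | x ∈ Set.Icc 0 Amax ∧ y ≤ marginal U x}

namespace Network

variable {K J : ℕ} {N : Network K J} {S : Type} [MeasurableSpace S]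

/-- Weighted sum rate, the objective of the scheduler. -/
def weightedRate (N : Network K J) (q : Fin K → ℝ) (h : Channel K J N.M) (v : Beam K J N.M) : ℝ :=
  ∑ k, q k / N.τ * N.rate h v k

/-- The policy is a run of the resource management algorithm with scaling factor `φ`:
the congestion controller applies `min {U'⁻¹(q̂ / (φ τ)), Amax}`, and the scheduler maximizes the
weighted sum rate under the power budgets and the delay constraint. The queues start empty and
are updated as in `Policy.queue` and `Policy.auxQueue`. The flow-split rule is an arbitrary causal
one. -/
structure IsAlgorithmRun (U : Fin K → ℝ → ℝ) (φ : ℝ) (σ : Measure S) (p : N.Policy S) : Prop where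
  congestion : ∀ n ω k,
    p.a n ω k = congestionRate (U k) N.Amax (p.auxQueue n ω k / (φ * N.τ))
  delay : ∀ n, ∀ᵐ ω ∂(N.prob σ), p.DelayOK n ω (p.w n ω)
  schedule : ∀ n, ∀ᵐ ω ∂(N.prob σ),
    IsMaxOn (N.weightedRate (p.auxQueue n ω) (ω.2.1 n))
      {v | v ∈ N.powerSet ∧ p.DelayOK n ω v} (p.w n ω)

/-- In the long run the delay constraint is not binding for the scheduler: the expected fraction of
slots in which the chosen beamformer does not maximize the weighted sum rate over the whole
instantaneous achievable rate region tends to zero. -/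
def DelaySlack (σ : Measure S) (p : N.Policy S) : Prop :=
  Tendsto (fun T : ℕ => (∑ n ∈ Finset.range T,
    (N.prob σ).real {ω | ¬ IsMaxOn (N.weightedRate (p.auxQueue n ω) (ω.2.1 n))
      N.powerSet (p.w n ω)}) / T) atTop (𝓝 0)

/-- `ρ` is the steady-state law of the auxiliary queue-length vector: the weak limit of the
time averages of its laws. -/
def IsSteadyState (σ : Measure S) (p : N.Policy S) (ρ : Measure (Fin K → ℝ)) : Prop :=
  IsProbabilityMeasure ρ ∧ ∀ f : BoundedContinuousFunction (Fin K → ℝ) ℝ,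
    Tendsto (fun T : ℕ =>
      (∑ n ∈ Finset.range T, ∫ ω, f (p.auxQueue n ω) ∂(N.prob σ)) / T) atTop (𝓝 (∫ q, f q ∂ρ))

/-- Mean steady-state congestion control rate vector. -/
def meanRate (N : Network K J) (U : Fin K → ℝ → ℝ) (φ : ℝ) (ρ : Measure (Fin K → ℝ)) :
    Fin K → ℝ :=
  fun k => ∫ q, congestionRate (U k) N.Amax (q k / (φ * N.τ)) ∂ρ

/-- `√(K τ² Ψ / 2 · (A₁ + rmax²))` -/
def C₁ (N : Network K J) (Ψ A₁ rmax : ℝ) : ℝ :=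
  √(K * N.τ ^ 2 * Ψ / 2 * (A₁ + rmax ^ 2))

/-- `C₁ / (ψ τ)` -/
def C₂ (N : Network K J) (ψ Ψ A₁ rmax : ℝ) : ℝ :=
  N.C₁ Ψ A₁ rmax / (ψ * N.τ)

/-- `Ψ C₁² / (2 ψ² τ²)` -/
def C₃ (N : Network K J) (ψ Ψ A₁ rmax : ℝ) : ℝ :=
  Ψ * N.C₁ Ψ A₁ rmax ^ 2 / (2 * ψ ^ 2 * N.τ ^ 2)

end Network

end

/-! ### Utilities and the congestion controller -/

namespace UtilityOK

variable {U : ℝ → ℝ} {ψ Ψ R A : ℝ}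

/-! This is a drift argument. Let `R` bound the rates and let `x` be the optimal rate vector. The
admitted rate `c` maximizes `U c - (q̂ / (φτ)) c` on `[0, Amax]`, so `U'(c) (x - c) ≤ (q̂ / (φτ)) (x
- c)` (`marginal_mul_le`). Outside a vanishing fraction of slots the scheduler attains the largest
weighted sum rate. Since the queues are independent of the current channel, the mean of that maximum
dominates `E ∑ q̂_k y_k` for every feasible rate vector `y` (`integral_weighted_le`). The Lyapunov
drift then bounds the steady-state mean of `∑ q̂_k (x_k - c_k)` by `Kτ(Amax² + R²)/4`. Dividing by
`φτ` gives `E ∑ U_k'(c_k) (x_k - c_k) ≤ K(Amax² + R²)/(4φ)`, and `Amax² ≤ A₁` because slot `0`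
admits at full rate.

Both claims follow by bounding `U'(c) (x - c)` below by a function affine in `c`, whose mean is its
value at the mean rate `z` (`sum_affine_le`). For the utility, concavity gives `U'(c) (x - c) ≥ U x
- U c`, and the tangent of `U` at `z` makes this affine. For the distance, strong monotonicity of
`-U'` gives an affine minorant worth `(3/4) ψ (z - x)²` at `c = z` (`affine_le_marginal_gap`). The
remaining term `∑ U_k'(x_k) (x_k - z_k)` is nonnegative by first-order optimality
(`sum_marginal_mul_nonpos`), which needs `z` to be feasible (the auxiliary queues are bounded) and
the feasible rates to be convex (toss a coin between two policies).

The factor `3/4` arises because admitted rates may leave the interval on which curvature is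
controlled. It is paid for by the drift constant, half of the one that `q²/2` alone gives. This
halving also makes the utility bound close when `Ψ` is near `ψ`. -/

theorem differentiableOn (hU : UtilityOK U ψ Ψ R) : DifferentiableOn ℝ U (Set.Ici 0) :=
  hU.contDiff.differentiableOn (by norm_num)

theorem contDiffOn_marginal (hU : UtilityOK U ψ Ψ R) :
    ContDiffOn ℝ 1 (marginal U) (Set.Ici 0) :=
  hU.contDiff.derivWithin (uniqueDiffOn_Ici 0) (by norm_num)

theorem continuousOn_marginal (hU : UtilityOK U ψ Ψ R) :
    ContinuousOn (marginal U) (Set.Ici 0) :=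
  hU.contDiffOn_marginal.continuousOn

theorem strictAntiOn_marginal (hU : UtilityOK U ψ Ψ R) :
    StrictAntiOn (marginal U) (Set.Ici 0) :=
  hU.concave.strictAntiOn_derivWithin hU.differentiableOn

theorem marginal_nonneg (hU : UtilityOK U ψ Ψ R) (x : ℝ) : 0 ≤ marginal U x :=
  hU.increasing.monotoneOn.derivWithin_nonneg

theorem le_tangent (hU : UtilityOK U ψ Ψ R) {x z : ℝ} (hx : 0 ≤ x) (hz : 0 ≤ z) :
    U x ≤ U z + marginal U z * (x - z) := by
  rcases lt_trichotomy x z with h | rfl | h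
  · have := hU.concave.concaveOn.derivWithin_le_slope hx hz h (hU.differentiableOn z hz)
    rw [slope_def_field, le_div_iff₀ (by linarith)] at this
    unfold marginal
    linarith
  · simp
  · have := hU.concave.concaveOn.slope_le_derivWithin hz hx h (hU.differentiableOn z hz)
    rw [slope_def_field, div_le_iff₀ (by linarith)] at this
    unfold marginal
    linarith

/-- The curvature bound `U'' ≤ -ψ` in derivative-free form, usable between any two points of `[0,
R]`. -/
theorem antitoneOn_marginal_add (hU : UtilityOK U ψ Ψ R) :
    AntitoneOn (fun x => marginal U x + ψ * x) (Set.Icc 0 R) := by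
  have hd : DifferentiableOn ℝ (marginal U) (Set.Ici 0) :=
    hU.contDiffOn_marginal.differentiableOn (by norm_num)
  refine antitoneOn_of_deriv_nonpos (convex_Icc 0 R) ?_ ?_ ?_
  · exact (hU.continuousOn_marginal.mono Set.Icc_subset_Ici_self).add (by fun_prop)
  · intro x hx
    rw [interior_Icc] at hx
    refine (((hd x hx.1.le).differentiableAt (Ici_mem_nhds hx.1)).add
      (by fun_prop)).differentiableWithinAt
  · intro x hx
    rw [interior_Icc] at hx
    have h1 := (hd x hx.1.le).differentiableAt (Ici_mem_nhds hx.1)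
    have h2 := (hU.curvature x ⟨hx.1.le, hx.2.le⟩).1
    rw [derivWithin_of_mem_nhds (Ici_mem_nhds hx.1)] at h2
    have h3 : HasDerivAt (fun x => marginal U x + ψ * x) (deriv (marginal U) x + ψ * 1) x :=
      h1.hasDerivAt.add ((hasDerivAt_id x).const_mul ψ)
    rw [h3.deriv]
    linarith

theorem strong_monotone (hU : UtilityOK U ψ Ψ R) {x z : ℝ} (hx : x ∈ Set.Icc 0 R)
    (hz : z ∈ Set.Icc 0 R) : ψ * (x - z) ^ 2 ≤ (marginal U x - marginal U z) * (z - x) := by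
  rcases le_total x z with h | h
  · have := hU.antitoneOn_marginal_add hx hz h
    simp only at this
    nlinarith [mul_nonneg (sub_nonneg.2 this) (sub_nonneg.2 h)]
  · have := hU.antitoneOn_marginal_add hz hx h
    simp only at this
    nlinarith [mul_nonneg (sub_nonneg.2 this) (sub_nonneg.2 h)]

/-- An affine minorant in `a` of the monotonicity gap of the marginal utility. The curvature is
only controlled on `[0, R]`, but `a` may exceed `R`. -/
theorem affine_le_marginal_gap (hU : UtilityOK U ψ Ψ R) (hψ : 0 < ψ) {x z a : ℝ}
    (hx : x ∈ Set.Icc 0 R) (hz : z ∈ Set.Icc 0 R) (ha : 0 ≤ a) :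
    ψ * ((z - x) * (a - x) - (z - x) ^ 2 / 4) ≤ (marginal U a - marginal U x) * (x - a) := by
  rcases le_or_gt a R with h | h
  · refine le_trans ?_ (hU.strong_monotone ⟨ha, h⟩ hx)
    refine mul_le_mul_of_nonneg_left ?_ hψ.le
    -- Tangent line to `t²` at `t = (z - x)/2`, with `t = a - x`. The tangent at `z - x` would lose
    -- nothing at `a = z`, but its slope `2(z - x)` may exceed `R - x`, and then it fails for large
    -- `a`.
    nlinarith [sq_nonneg ((a - x) - (z - x) / 2)]
  -- Beyond `R` only `U' a ≤ U' R` is known. The gap still grows with slope at least `ψ(R - x) ≥ ψ(z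
  -- - x)`.
  · have hR : R ∈ Set.Icc 0 R := ⟨hx.1.trans hx.2, le_rfl⟩
    have h1 := hU.antitoneOn_marginal_add hx hR hx.2
    simp only at h1
    have h2 : marginal U a ≤ marginal U R :=
      hU.strictAntiOn_marginal.antitoneOn hR.1 ha h.le
    have h3 : ψ * (R - x) ≤ marginal U x - marginal U a := by linarith
    have h4 : 0 ≤ a - x := by linarith [hx.2]
    calc ψ * ((z - x) * (a - x) - (z - x) ^ 2 / 4) ≤ ψ * ((R - x) * (a - x)) := by
          refine mul_le_mul_of_nonneg_left ?_ hψ.le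
          nlinarith [sq_nonneg (z - x), mul_nonneg (sub_nonneg.2 hz.2) h4]
      _ ≤ (marginal U x - marginal U a) * (a - x) := by
          rw [← mul_assoc]; exact mul_le_mul_of_nonneg_right h3 h4
      _ = _ := by ring

theorem congestionRate_marginal (hU : UtilityOK U ψ Ψ R) {x : ℝ} (hx : x ∈ Set.Icc 0 A) :
    congestionRate U A (marginal U x) = x := by
  have : {z | z ∈ Set.Icc 0 A ∧ marginal U x ≤ marginal U z} = Set.Icc 0 x := by
    ext z
    constructor
    · rintro ⟨hz, h⟩
      exact ⟨hz.1, (hU.strictAntiOn_marginal.le_iff_ge hx.1 hz.1).1 h⟩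
    · intro hz
      exact ⟨⟨hz.1, hz.2.trans hx.2⟩, (hU.strictAntiOn_marginal.le_iff_ge hx.1 hz.1).2 hz.2⟩
  rw [congestionRate, this, csSup_Icc hx.1]

theorem congestionRate_of_le (hU : UtilityOK U ψ Ψ R) (hA : 0 ≤ A) {y : ℝ}
    (hy : y ≤ marginal U A) : congestionRate U A y = A := by
  have : {z | z ∈ Set.Icc 0 A ∧ y ≤ marginal U z} = Set.Icc 0 A := by
    ext z
    constructor
    · rintro ⟨hz, h⟩
      exact hz
    · intro hz
      exact ⟨hz, hy.trans (hU.strictAntiOn_marginal.antitoneOn hz.1 hA hz.2)⟩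
  rw [congestionRate, this, csSup_Icc hA]

theorem congestionRate_of_ge (hU : UtilityOK U ψ Ψ R) (hA : 0 ≤ A) {y : ℝ}
    (hy : marginal U 0 ≤ y) : congestionRate U A y = 0 := by
  rcases hy.eq_or_lt with rfl | hy
  · exact hU.congestionRate_marginal ⟨le_rfl, hA⟩
  have : {z | z ∈ Set.Icc 0 A ∧ y ≤ marginal U z} = ∅ := by
    ext z
    simp only [Set.mem_ofPred_eq, Set.mem_empty_iff_false, iff_false, not_and, not_le]
    intro hz
    exact (hU.strictAntiOn_marginal.antitoneOn (Set.mem_Ici.2 le_rfl) hz.1 hz.1).trans_lt hy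
  rw [congestionRate, this, Real.sSup_empty]

/-- The KKT alternatives for maximizing `U x - y x` on `[0, A]`: upper end, lower end, or a
stationary point. -/
theorem congestionRate_cases (hU : UtilityOK U ψ Ψ R) (hA : 0 ≤ A) (y : ℝ) :
    (y ≤ marginal U A ∧ congestionRate U A y = A) ∨
    (marginal U 0 ≤ y ∧ congestionRate U A y = 0) ∨
    (congestionRate U A y ∈ Set.Icc 0 A ∧ y = marginal U (congestionRate U A y)) := by
  rcases le_or_gt y (marginal U A) with h | h
  · exact Or.inl ⟨h, hU.congestionRate_of_le hA h⟩
  rcases le_or_gt (marginal U 0) y with h' | h'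
  · exact Or.inr (Or.inl ⟨h', hU.congestionRate_of_ge hA h'⟩)
  obtain ⟨x, hx, rfl⟩ := intermediate_value_Icc' hA
    (hU.continuousOn_marginal.mono Set.Icc_subset_Ici_self) ⟨h.le, h'.le⟩
  rw [hU.congestionRate_marginal hx]
  exact Or.inr (Or.inr ⟨hx, rfl⟩)

theorem congestionRate_mem (hU : UtilityOK U ψ Ψ R) (hA : 0 ≤ A) (y : ℝ) :
    congestionRate U A y ∈ Set.Icc 0 A := by
  rcases hU.congestionRate_cases hA y with ⟨-, h⟩ | ⟨-, h⟩ | ⟨h, -⟩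
  · rw [h]; exact ⟨hA, le_rfl⟩
  · rw [h]; exact ⟨le_rfl, hA⟩
  · exact h

/-- The congestion controller maximizes `U x - y x` over `[0, A]`, in first-order form. -/
theorem marginal_mul_le (hU : UtilityOK U ψ Ψ R) (hA : 0 ≤ A) (y : ℝ) {x : ℝ}
    (hx : x ∈ Set.Icc 0 A) :
    marginal U (congestionRate U A y) * (x - congestionRate U A y)
      ≤ y * (x - congestionRate U A y) := by
  rcases hU.congestionRate_cases hA y with ⟨h, h'⟩ | ⟨h, h'⟩ | ⟨-, h⟩
  · rw [h']; nlinarith [hx.2]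
  · rw [h']; nlinarith [hx.1]
  · rw [← h]

/-- A monotone surjection onto an interval is continuous. The order dual appears because the rate
decreases in the price. -/
theorem continuous_congestionRate (hU : UtilityOK U ψ Ψ R) (hA : 0 ≤ A) :
    Continuous (congestionRate U A) := by
  let g : ℝ → (Set.Icc 0 A)ᵒᵈ := fun y => OrderDual.toDual ⟨_, hU.congestionRate_mem hA y⟩
  have hmono : Monotone g := by
    intro y y' h
    change congestionRate U A y' ≤ congestionRate U A y
    unfold congestionRate
    rcases Set.eq_empty_or_nonempty {x | x ∈ Set.Icc 0 A ∧ y' ≤ marginal U x} with h0 | h0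
    · rw [h0, Real.sSup_empty]
      exact (hU.congestionRate_mem hA y).1
    · exact csSup_le_csSup ⟨A, fun x hx => hx.1.2⟩ h0 fun x hx => ⟨hx.1, h.trans hx.2⟩
  have hsurj : Function.Surjective g := by
    intro x
    refine ⟨marginal U (OrderDual.ofDual x : Set.Icc 0 A), ?_⟩
    apply OrderDual.ofDual.injective
    exact Subtype.ext (hU.congestionRate_marginal (OrderDual.ofDual x).2)
  have := hmono.continuous_of_surjective hsurj
  exact continuous_subtype_val.comp (continuous_ofDual.comp this)

theorem congestionRate_clip (hU : UtilityOK U ψ Ψ R) (hA : 0 ≤ A) {b c : ℝ} (hc : 0 < c)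
    (hb : marginal U 0 * c ≤ b) (q : ℝ) :
    congestionRate U A (max 0 (min q b) / c) = congestionRate U A (q / c) := by
  have hb0 : 0 ≤ b := (mul_nonneg (hU.marginal_nonneg 0) hc.le).trans hb
  rcases le_or_gt q 0 with h | h
  · rw [max_eq_left (min_le_of_left_le h), zero_div,
      hU.congestionRate_of_le hA (hU.marginal_nonneg A),
      hU.congestionRate_of_le hA ((div_nonpos_of_nonpos_of_nonneg h hc.le).trans
        (hU.marginal_nonneg A))]
  · rcases le_or_gt q b with h' | h'
    · rw [min_eq_left h', max_eq_right h.le]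
    · rw [min_eq_right h'.le, max_eq_right hb0, hU.congestionRate_of_ge hA
        ((le_div_iff₀ hc).2 hb), hU.congestionRate_of_ge hA
        ((le_div_iff₀ hc).2 (hb.trans h'.le))]

end UtilityOK

/-! ### One-slot drift -/

/-- Drift of the Lyapunov function `q ^ 2 / 2 + (R - A) / 2 * τ * q` of a queue with arrivals in
`[0, A]` and services in `[0, R]`. The linear term halves the constant of the quadratic one. -/
theorem queue_drift_le {A R τ q a r : ℝ} (hτ : 0 < τ) (hq : 0 ≤ q) (ha : a ∈ Set.Icc 0 A)
    (hr : r ∈ Set.Icc 0 R) :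
    max 0 (q + a * τ - r * τ) ^ 2 / 2 + (R - A) / 2 * τ * max 0 (q + a * τ - r * τ)
      ≤ q ^ 2 / 2 + (R - A) / 2 * τ * q + τ * (q * (a - r)) + τ ^ 2 / 4 * (A ^ 2 + R ^ 2) := by
  obtain ⟨x, rfl⟩ : ∃ x, q = τ * x := ⟨q / τ, by field_simp⟩
  have hx : 0 ≤ x := nonneg_of_mul_nonneg_right hq hτ
  have hA : 0 ≤ A := ha.1.trans ha.2
  have hR : 0 ≤ R := hr.1.trans hr.2
  have hd1 : 0 ≤ A - (a - r) := by linarith [ha.2, hr.1]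
  have hd2 : 0 ≤ R + (a - r) := by linarith [ha.1, hr.2]
  have e : τ * x + a * τ - r * τ = τ * (x + (a - r)) := by ring
  rw [e]
  have hτ2 : 0 ≤ τ ^ 2 := sq_nonneg τ
  rcases le_or_gt 0 (x + (a - r)) with h | h
  · rw [max_eq_right (mul_nonneg hτ.le h)]
    -- With `d = a - r` in `[-R, A]`, `(A - d)(R + d) ≥ 0` gives `d²/2 + (R - A)d/2 ≤ AR/2 ≤ (A² +
    -- R²)/4`. The linear Lyapunov term is chosen to absorb exactly this `d`.
    have : 0 ≤ (A ^ 2 + R ^ 2) / 4 - (a - r) ^ 2 / 2 - (R - A) / 2 * (a - r) := by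
      nlinarith [mul_nonneg hd1 hd2, sq_nonneg (A - R)]
    nlinarith [mul_nonneg hτ2 this]
  · rw [max_eq_left (mul_nonpos_of_nonneg_of_nonpos hτ.le h.le)]
    have : 0 ≤ x ^ 2 / 2 + (R - A) / 2 * x + x * (a - r) + (A ^ 2 + R ^ 2) / 4 := by
      rcases le_total A R with hAR | hAR
      · rcases le_total 0 ((R - A) / 2 + (a - r)) with h' | h'
        · nlinarith [mul_nonneg hx h', sq_nonneg x, sq_nonneg A, sq_nonneg R]
        -- Complete the square in `x`: the minimum costs at most `(R + A)²/8`, which is at most `(A²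
        -- + R²)/4`.
        · have h1 : ((R - A) / 2 + (a - r)) ^ 2 ≤ ((R + A) / 2) ^ 2 := by
            apply sq_le_sq'
            · linarith
            · linarith
          nlinarith [sq_nonneg (x + ((R - A) / 2 + (a - r))), sq_nonneg (A - R)]
      · have h1 : 0 ≤ R - x := by linarith
        nlinarith [mul_nonneg hx h1, mul_nonneg hx hd2, mul_nonneg h1 (sub_nonneg.2 hAR),
          sq_nonneg (A - R), mul_nonneg hA h1]
    nlinarith [mul_nonneg hτ2 this]

namespace Network

variable {K J : ℕ} {N : Network K J} {S : Type} [MeasurableSpace S]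

/-! ### Rates -/

theorem interference_pos (h : Channel K J N.M) (w : Beam K J N.M) (k : Fin K) (j : Fin J) :
    0 < N.interference h w k j := by
  have := N.N₀_pos
  unfold interference
  positivity

theorem sinr_nonneg (h : Channel K J N.M) (w : Beam K J N.M) (k : Fin K) (j : Fin J) :
    0 ≤ N.sinr h w k j :=
  div_nonneg (sq_nonneg _) (interference_pos h w k j).le

theorem pathRate_nonneg (h : Channel K J N.M) (w : Beam K J N.M) (k : Fin K) (j : Fin J) :
    0 ≤ N.pathRate h w k j :=
  mul_nonneg N.W_pos.le (Real.logb_nonneg (by norm_num) (by linarith [sinr_nonneg h w k j]))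

theorem rate_nonneg (h : Channel K J N.M) (w : Beam K J N.M) (k : Fin K) : 0 ≤ N.rate h w k :=
  Finset.sum_nonneg fun j _ => pathRate_nonneg h w k j

theorem continuous_pathRate (k : Fin K) (j : Fin J) :
    Continuous fun x : Channel K J N.M × Beam K J N.M => N.pathRate x.1 x.2 k j := by
  have hin : ∀ k' j', Continuous fun x : Channel K J N.M × Beam K J N.M =>
      ‖inner ℂ (x.1 k j') (x.2 k' j')‖ ^ 2 := by
    intro k' j'
    fun_prop
  have hI : Continuous fun x : Channel K J N.M × Beam K J N.M =>
      N.interference x.1 x.2 k j := by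
    unfold interference
    exact ((continuous_finsetSum _ fun j' _ => hin k j').add
      (continuous_finsetSum _ fun k' _ => continuous_finsetSum _ fun j' _ => hin k' j')).add
      continuous_const
  have hs : Continuous fun x : Channel K J N.M × Beam K J N.M => N.sinr x.1 x.2 k j :=
    (hin k j).div hI fun x => (interference_pos x.1 x.2 k j).ne'
  unfold pathRate Real.logb
  refine continuous_const.mul (Continuous.div_const (Continuous.log (continuous_const.add hs)
    fun x => (?_ : (1 : ℝ) + N.sinr x.1 x.2 k j ≠ 0)) _)
  have := sinr_nonneg x.1 x.2 k j
  positivity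

theorem continuous_rate (k : Fin K) :
    Continuous fun x : Channel K J N.M × Beam K J N.M => N.rate x.1 x.2 k :=
  continuous_finsetSum _ fun j _ => continuous_pathRate k j

theorem _root_.Measurable.uncurry_comp {Ω α β : Type*} {m : MeasurableSpace Ω}
    [MeasurableSpace α] [MeasurableSpace β] {F : α → β → ℝ} {f : Ω → α} {g : Ω → β}
    (hF : Measurable fun x : α × β => F x.1 x.2) (hf : Measurable f) (hg : Measurable g) :
    Measurable fun ω => F (f ω) (g ω) :=
  hF.comp (hf.prodMk hg)

theorem _root_.Measurable.pathRate {Ω : Type*} {m : MeasurableSpace Ω} {h : Ω → Channel K J N.M}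
    {w : Ω → Beam K J N.M} (hh : Measurable h) (hw : Measurable w) (k : Fin K) (j : Fin J) :
    Measurable fun ω => N.pathRate (h ω) (w ω) k j :=
  Measurable.uncurry_comp (F := fun h w => N.pathRate h w k j)
    (continuous_pathRate (N := N) k j).measurable hh hw

theorem _root_.Measurable.rate {Ω : Type*} {m : MeasurableSpace Ω} {h : Ω → Channel K J N.M}
    {w : Ω → Beam K J N.M} (hh : Measurable h) (hw : Measurable w) (k : Fin K) :
    Measurable fun ω => N.rate (h ω) (w ω) k :=
  Measurable.uncurry_comp (F := fun h w => N.rate h w k)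
    (continuous_rate (N := N) k).measurable hh hw

theorem _root_.Measurable.queueUpdate {Ω : Type*} {m : MeasurableSpace Ω} {q a r : Ω → ℝ}
    (hq : Measurable q) (ha : Measurable a) (hr : Measurable r) (τ : ℝ) :
    Measurable fun ω => max 0 (q ω + a ω * τ - r ω * τ) := by
  fun_prop

/-! ### Information -/

theorem measurable_info_seed (n : ℕ) : Measurable[N.info S n] fun ω : N.Sample S => ω.1 :=
  measurable_iff_comap_le.2 (le_sup_of_le_left le_sup_left)

theorem measurable_info_channel {m n : ℕ} (h : m < n) :
    Measurable[N.info S n] fun ω : N.Sample S => ω.2.1 m :=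
  measurable_iff_comap_le.2 (le_sup_of_le_left (le_sup_of_le_right
    (le_iSup₂ (f := fun (m : ℕ) (_ : m < n) =>
      MeasurableSpace.comap (fun ω : N.Sample S => ω.2.1 m) inferInstance) m h)))

theorem measurable_info_arrival {t n : ℕ} (h : t * N.Tf < n) :
    Measurable[N.info S n] fun ω : N.Sample S => ω.2.2 t :=
  measurable_iff_comap_le.2 (le_sup_of_le_right
    (le_iSup₂ (f := fun (t : ℕ) (_ : t * N.Tf < n) =>
      MeasurableSpace.comap (fun ω : N.Sample S => ω.2.2 t) inferInstance) t h))

theorem info_le_iff {n : ℕ} {m : MeasurableSpace (N.Sample S)} :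
    N.info S n ≤ m ↔ Measurable[m] (fun ω : N.Sample S => ω.1) ∧
      (∀ i < n, Measurable[m] fun ω : N.Sample S => ω.2.1 i) ∧
      ∀ t, t * N.Tf < n → Measurable[m] fun ω : N.Sample S => ω.2.2 t := by
  simp only [info, sup_le_iff, iSup_le_iff, measurable_iff_comap_le, and_assoc]

theorem info_mono {m n : ℕ} (h : m ≤ n) : N.info S m ≤ N.info S n :=
  info_le_iff.2 ⟨measurable_info_seed n, fun _ hi => measurable_info_channel (hi.trans_le h),
    fun _ ht => measurable_info_arrival (ht.trans_le h)⟩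

theorem info_le (n : ℕ) :
    N.info S n ≤ (inferInstance : MeasurableSpace (N.Sample S)) :=
  info_le_iff.2 ⟨measurable_fst, fun _ _ => by fun_prop, fun _ _ => by fun_prop⟩

instance isProbabilityMeasure_prob (σ : Measure S) [IsProbabilityMeasure σ] :
    IsProbabilityMeasure (N.prob σ) := by
  have := N.chan_prob
  have := N.arr_prob
  unfold prob
  infer_instance

theorem measurePreserving_channel (σ : Measure S) [IsProbabilityMeasure σ] (n : ℕ) :
    MeasurePreserving (fun ω : N.Sample S => ω.2.1 n) (N.prob σ) N.chan := by
  have := N.chan_prob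
  have := N.arr_prob
  have h1 : MeasurePreserving (fun ω : N.Sample S => ω.2) (N.prob σ)
      ((Measure.infinitePi fun _ : ℕ => N.chan).prod N.arr) := measurePreserving_snd
  have h2 : MeasurePreserving (fun ω : (ℕ → Channel K J N.M) × (ℕ → Fin K → ℝ) => ω.1)
      ((Measure.infinitePi fun _ : ℕ => N.chan).prod N.arr)
      (Measure.infinitePi fun _ : ℕ => N.chan) := measurePreserving_fst
  exact ((measurePreserving_eval_infinitePi (fun _ : ℕ => N.chan) n).comp h2).comp h1

/-- The channel of slot `n` is independent of the information available before that slot. -/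
theorem indepFun_channel (σ : Measure S) [IsProbabilityMeasure σ] (n : ℕ) {E : Type*}
    [MeasurableSpace E] {X : N.Sample S → E} (hX : Measurable[N.info S n] X) :
    ProbabilityTheory.IndepFun X (fun ω : N.Sample S => ω.2.1 n) (N.prob σ) := by
  have := N.chan_prob
  have := N.arr_prob
  let π := Measure.infinitePi fun _ : ℕ => N.chan
  -- It records more than the available information, namely all arrivals including future ones. They
  -- are independent of the channels, so this costs nothing.
  let past : N.Sample S → (S × (ℕ → Fin K → ℝ)) × (Finset.range n → Channel K J N.M) :=
    fun ω => ((ω.1, ω.2.2), fun i => ω.2.1 i)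
  have hpast : Measurable past := by fun_prop
  have hle : N.info S n ≤ MeasurableSpace.comap past inferInstance := by
    refine info_le_iff.2 ⟨?_, fun i hi => ?_, fun t _ => ?_⟩
    · exact (measurable_fst.comp measurable_fst).comp (comap_measurable past)
    · exact ((measurable_pi_apply (⟨i, Finset.mem_range.2 hi⟩ : Finset.range n)).comp
        measurable_snd).comp (comap_measurable past)
    · exact ((measurable_pi_apply t).comp (measurable_snd.comp measurable_fst)).comp
        (comap_measurable past)
  have key : ProbabilityTheory.IndepFun past (fun ω : N.Sample S => ω.2.1 n) (N.prob σ) := by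
    have hind : ProbabilityTheory.iIndepFun (fun (i : ℕ) (y : ℕ → Channel K J N.M) => y i) π :=
      ProbabilityTheory.iIndepFun_infinitePi (P := fun _ : ℕ => N.chan)
        (X := fun _ (y : Channel K J N.M) => y) (fun _ => measurable_id)
    have hdisj : Disjoint (Finset.range n) {n} := by simp
    have h1 : ProbabilityTheory.IndepFun
        (fun (y : ℕ → Channel K J N.M) (i : Finset.range n) => y i) (fun y => y n) π :=
      (hind.indepFun_finset (Finset.range n) {n} hdisj (fun i => measurable_pi_apply i)).comp
        measurable_id (measurable_pi_apply (⟨n, Finset.mem_singleton_self n⟩ : ({n} : Finset ℕ)))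
    rw [ProbabilityTheory.indepFun_iff_map_prod_eq_prod_map_map
      (Measurable.aemeasurable (by fun_prop)) (Measurable.aemeasurable (by fun_prop))] at h1
    have hT : MeasurePreserving (fun ω : N.Sample S => ((ω.1, ω.2.2), ω.2.1)) (N.prob σ)
        ((σ.prod N.arr).prod π) := by
      have e1 : MeasurePreserving (Prod.map id Prod.swap : N.Sample S → _) (N.prob σ)
          (σ.prod (N.arr.prod π)) :=
        (MeasurePreserving.id σ).prod Measure.measurePreserving_swap
      exact (MeasurePreserving.symm _ (measurePreserving_prodAssoc σ N.arr π)).comp e1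
    have hR : Measurable fun y : ℕ → Channel K J N.M =>
      ((fun i : Finset.range n => y i), y n) := by fun_prop
    have hM : MeasurePreserving (fun y : ℕ → Channel K J N.M =>
        ((fun i : Finset.range n => y i), y n)) π
        ((π.map fun y (i : Finset.range n) => y i).prod (π.map fun y => y n)) :=
      ⟨by fun_prop, h1⟩
    have : IsProbabilityMeasure (π.map fun y (i : Finset.range n) => y i) :=
      Measure.isProbabilityMeasure_map (Measurable.aemeasurable (by fun_prop))
    have : IsProbabilityMeasure (π.map fun y => y n) :=
      Measure.isProbabilityMeasure_map (Measurable.aemeasurable (by fun_prop))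
    have hF := (MeasurePreserving.symm _ (measurePreserving_prodAssoc (σ.prod N.arr)
      (π.map fun y (i : Finset.range n) => y i) (π.map fun y => y n))).comp
      (((MeasurePreserving.id (σ.prod N.arr)).prod hM).comp hT)
    have hF1 := measurePreserving_fst.comp hF
    have hF2 := measurePreserving_snd.comp hF
    rw [ProbabilityTheory.indepFun_iff_map_prod_eq_prod_map_map
      (by fun_prop) (by fun_prop)]
    refine hF.map_eq.trans ?_
    rw [← hF1.map_eq, ← hF2.map_eq]
    rfl
  rw [ProbabilityTheory.IndepFun_iff_Indep] at key ⊢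
  exact ProbabilityTheory.indep_of_indep_of_le_left key
    ((measurable_iff_comap_le.1 (hX.mono hle le_rfl)))

namespace Policy

variable (p : N.Policy S)

theorem measurable_r (n : ℕ) (k : Fin K) :
    Measurable[N.info S (n + 1)] fun ω => p.r n ω k :=
  Measurable.rate (measurable_info_channel n.lt_succ_self) (p.w_meas n) k

theorem measurable_a_apply (n : ℕ) (k : Fin K) :
    Measurable[N.info S (n + 1)] fun ω => p.a n ω k :=
  (measurable_pi_apply k).comp (p.a_meas n)

/-- The index is `n` and not `n + 1`: the queue at the start of slot `n` has not seen the channel of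
that slot, which gives their independence. -/
theorem measurable_auxQueue_apply (n : ℕ) (k : Fin K) :
    Measurable[N.info S n] fun ω => p.auxQueue n ω k := by
  induction n with
  | zero => exact measurable_const
  | succ n ih =>
    exact Measurable.queueUpdate (ih.mono (info_mono n.le_succ) le_rfl)
      (p.measurable_a_apply n k) (p.measurable_r n k) N.τ

theorem measurable_auxQueue (n : ℕ) : Measurable[N.info S n] (p.auxQueue n) :=
  @measurable_pi_lambda _ _ _ (N.info S n) _ _ (p.measurable_auxQueue_apply n)

theorem measurable_queue (n : ℕ) (k : Fin K) (j : Fin J) :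
    Measurable fun ω => p.queue n ω k j := by
  induction n with
  | zero => exact measurable_const
  | succ n ih =>
    have hβ : Measurable fun ω => p.β (n / N.Tf) ω k j :=
      (measurable_pi_apply j).comp ((measurable_pi_apply k).comp
        ((p.β_meas (n / N.Tf)).mono (info_le _) le_rfl))
    have hr : Measurable fun ω : N.Sample S => N.pathRate (ω.2.1 n) (p.w n ω) k j :=
      Measurable.pathRate (by fun_prop) ((p.w_meas n).mono (info_le _) le_rfl) k j
    have hA : Measurable fun ω : N.Sample S => ω.2.2 (n / N.Tf) k := by fun_prop
    exact Measurable.queueUpdate ih (hβ.mul hA) hr N.τ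

theorem auxQueue_nonneg (n : ℕ) (ω : N.Sample S) (k : Fin K) : 0 ≤ p.auxQueue n ω k := by
  cases n with
  | zero => exact le_rfl
  | succ n => exact le_max_left _ _

theorem auxQueue_succ (n : ℕ) (ω : N.Sample S) (k : Fin K) :
    p.auxQueue (n + 1) ω k = max 0 (p.auxQueue n ω k + p.a n ω k * N.τ - p.r n ω k * N.τ) :=
  rfl

theorem r_nonneg (n : ℕ) (ω : N.Sample S) (k : Fin K) : 0 ≤ p.r n ω k := rate_nonneg _ _ _

end Policy

end Network

noncomputable section

namespace Network

variable {K J : ℕ} {N : Network K J} {S : Type} [MeasurableSpace S]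

/-! ### The largest weighted sum rate -/

instance nonempty_powerSet : Nonempty N.powerSet :=
  ⟨⟨0, fun j => by simpa using (N.Pmax_pos j).le⟩⟩

theorem _root_.DenseRange.le_of_forall_le {ι X : Type*} [TopologicalSpace X] {u : ι → X}
    (hu : DenseRange u) {F : X → ℝ} (hF : Continuous F) {C : ℝ} (h : ∀ i, F (u i) ≤ C) (x : X) :
    F x ≤ C :=
  hu.induction_on x (isClosed_le hF continuous_const) h

theorem continuous_rate_right (h : Channel K J N.M) (k : Fin K) :
    Continuous fun w : Beam K J N.M => N.rate h w k :=
  Continuous.uncurry_left (f := fun h w => N.rate h w k) h (continuous_rate (N := N) k)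

/-- Largest weighted sum rate for the channel `h`, as a supremum over a dense sequence of
beamformers. -/
def maxWeighted (N : Network K J) (q : Fin K → ℝ) (h : Channel K J N.M) : ℝ :=
  ⨆ i : ℕ, ∑ k, q k * N.rate h (TopologicalSpace.denseSeq N.powerSet i : Beam K J N.M) k

theorem measurable_maxWeighted :
    Measurable fun x : (Fin K → ℝ) × Channel K J N.M => N.maxWeighted x.1 x.2 := by
  unfold maxWeighted
  refine Measurable.iSup fun i => Finset.measurable_sum _ fun k _ => Measurable.mul ?_ ?_
  · exact (measurable_pi_apply k).comp measurable_fst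
  · exact Measurable.rate measurable_snd measurable_const k

theorem weighted_le_maxWeighted {R : ℝ} {q : Fin K → ℝ} (hq : ∀ k, 0 ≤ q k)
    {h : Channel K J N.M} (hR : ∀ w ∈ N.powerSet, ∀ k, N.rate h w k ≤ R) {w : Beam K J N.M}
    (hw : w ∈ N.powerSet) : ∑ k, q k * N.rate h w k ≤ N.maxWeighted q h := by
  have hcont : Continuous fun v : Beam K J N.M => ∑ k, q k * N.rate h v k :=
    continuous_finsetSum _ fun k _ => continuous_const.mul (continuous_rate_right (N := N) h k)
  have hcont' : Continuous fun v : N.powerSet => ∑ k, q k * N.rate h v.1 k :=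
    hcont.comp continuous_subtype_val
  -- An unbounded real supremum would be `0` by convention; the rate bound excludes this.
  have hbdd : BddAbove (Set.range fun i : ℕ =>
      ∑ k, q k * N.rate h (TopologicalSpace.denseSeq N.powerSet i : Beam K J N.M) k) := by
    refine ⟨∑ k, q k * R, ?_⟩
    rintro _ ⟨i, rfl⟩
    exact Finset.sum_le_sum fun k _ => mul_le_mul_of_nonneg_left
      (hR _ (TopologicalSpace.denseSeq N.powerSet i).2 k) (hq k)
  exact (TopologicalSpace.denseRange_denseSeq N.powerSet).le_of_forall_le hcont'
    (fun i => le_ciSup hbdd i) ⟨w, hw⟩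

theorem maxWeighted_le {q : Fin K → ℝ} {h : Channel K J N.M} {C : ℝ}
    (hC : ∀ w ∈ N.powerSet, ∑ k, q k * N.rate h w k ≤ C) : N.maxWeighted q h ≤ C :=
  ciSup_le fun i => hC _ (TopologicalSpace.denseSeq N.powerSet i).2

theorem maxWeighted_nonneg {q : Fin K → ℝ} (hq : ∀ k, 0 ≤ q k) (h : Channel K J N.M) :
    0 ≤ N.maxWeighted q h :=
  Real.iSup_nonneg fun _ => Finset.sum_nonneg fun k _ => mul_nonneg (hq k) (rate_nonneg _ _ k)

theorem maxWeighted_le_of_rate_le {R : ℝ} {q : Fin K → ℝ} (hq : ∀ k, 0 ≤ q k)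
    {h : Channel K J N.M} (hR : ∀ w ∈ N.powerSet, ∀ k, N.rate h w k ≤ R) :
    N.maxWeighted q h ≤ ∑ k, q k * R :=
  maxWeighted_le fun w hw => Finset.sum_le_sum fun k _ =>
    mul_le_mul_of_nonneg_left (hR w hw k) (hq k)

/-! ### Average rates of a policy -/

namespace Policy

variable (p : N.Policy S) (σ : Measure S) [IsProbabilityMeasure σ]

theorem a_le (n : ℕ) (ω : N.Sample S) (k : Fin K) : p.a n ω k ≤ N.Amax := (p.a_mem n ω k).2

theorem a_nonneg (n : ℕ) (ω : N.Sample S) (k : Fin K) : 0 ≤ p.a n ω k := (p.a_mem n ω k).1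

theorem integrable_a (n : ℕ) (k : Fin K) : Integrable (fun ω => p.a n ω k) (N.prob σ) := by
  refine Integrable.of_bound ((p.measurable_a_apply n k).mono (info_le _) le_rfl).aestronglyMeasurable
    N.Amax (ae_of_all _ fun ω => ?_)
  rw [Real.norm_of_nonneg (p.a_nonneg n ω k)]
  exact p.a_le n ω k

variable {R : ℝ} (hR : ∀ᵐ h ∂N.chan, ∀ w ∈ N.powerSet, ∀ k, N.rate h w k ≤ R)
include hR

theorem ae_rate_le (n : ℕ) :
    ∀ᵐ ω ∂(N.prob σ), ∀ w ∈ N.powerSet, ∀ k, N.rate (ω.2.1 n) w k ≤ R :=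
  (measurePreserving_channel σ n).quasiMeasurePreserving.ae hR

theorem ae_r_le (n : ℕ) : ∀ᵐ ω ∂(N.prob σ), ∀ k, p.r n ω k ≤ R := by
  filter_upwards [ae_rate_le σ hR n] with ω hω k using hω _ (p.w_mem n ω) k

theorem integrable_r (n : ℕ) (k : Fin K) : Integrable (fun ω => p.r n ω k) (N.prob σ) := by
  refine Integrable.of_bound ((p.measurable_r n k).mono (info_le _) le_rfl).aestronglyMeasurable
    R ?_
  filter_upwards [p.ae_r_le σ hR n] with ω hω
  rw [Real.norm_of_nonneg (p.r_nonneg n ω k)]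
  exact hω k

theorem integral_r_le (n : ℕ) (k : Fin K) : ∫ ω, p.r n ω k ∂(N.prob σ) ≤ R := by
  calc ∫ ω, p.r n ω k ∂(N.prob σ) ≤ ∫ _, R ∂(N.prob σ) := by
        refine integral_mono_ae (p.integrable_r σ hR n k) (integrable_const R) ?_
        filter_upwards [p.ae_r_le σ hR n] with ω hω using hω k
    _ = R := by simp

omit [IsProbabilityMeasure σ] hR in
theorem average_r_nonneg (k : Fin K) (T : ℕ) :
    0 ≤ (∑ n ∈ Finset.range T, ∫ ω, p.r n ω k ∂(N.prob σ)) / T :=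
  div_nonneg (Finset.sum_nonneg fun n _ => integral_nonneg fun ω => p.r_nonneg n ω k)
    (Nat.cast_nonneg T)

theorem average_r_le (hR0 : 0 ≤ R) (k : Fin K) (T : ℕ) :
    (∑ n ∈ Finset.range T, ∫ ω, p.r n ω k ∂(N.prob σ)) / T ≤ R := by
  refine div_le_of_le_mul₀ (Nat.cast_nonneg T) hR0 ?_
  refine (Finset.sum_le_sum fun n _ => p.integral_r_le σ hR n k).trans ?_
  simp [mul_comm]

omit [IsProbabilityMeasure σ] hR in
theorem isBoundedUnder_average_r (k : Fin K) :
    IsBoundedUnder (· ≥ ·) atTop fun T : ℕ =>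
      (∑ n ∈ Finset.range T, ∫ ω, p.r n ω k ∂(N.prob σ)) / T :=
  isBoundedUnder_of ⟨0, p.average_r_nonneg σ k⟩

theorem isCoboundedUnder_average_r (hR0 : 0 ≤ R) (k : Fin K) :
    IsCoboundedUnder (· ≥ ·) atTop fun T : ℕ =>
      (∑ n ∈ Finset.range T, ∫ ω, p.r n ω k ∂(N.prob σ)) / T :=
  (isBoundedUnder_of (r := (· ≤ ·)) ⟨R, p.average_r_le σ hR hR0 k⟩).isCoboundedUnder_ge

theorem avgRate_le (hR0 : 0 ≤ R) (k : Fin K) : p.avgRate σ k ≤ R :=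
  liminf_le_of_frequently_le (Frequently.of_forall (p.average_r_le σ hR hR0 k))
    (p.isBoundedUnder_average_r σ k)

omit hR in
theorem Feasible.mem_Icc {p : N.Policy S} {σ : Measure S} [IsProbabilityMeasure σ]
    {abar : Fin K → ℝ} (h : p.Feasible σ abar) (k : Fin K) : abar k ∈ Set.Icc 0 N.Amax := by
  refine isClosed_Icc.mem_of_tendsto (h.avg k) (Eventually.of_forall fun T => ⟨?_, ?_⟩)
  · exact div_nonneg (Finset.sum_nonneg fun n _ => integral_nonneg fun ω => p.a_nonneg n ω k)
      (Nat.cast_nonneg T)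
  · refine div_le_of_le_mul₀ (Nat.cast_nonneg T) N.Amax_pos.le ?_
    have : ∀ n, ∫ ω, p.a n ω k ∂(N.prob σ) ≤ N.Amax := fun n =>
      (integral_mono (p.integrable_a σ n k) (integrable_const _)
        fun ω => p.a_le n ω k).trans_eq (by simp)
    refine (Finset.sum_le_sum fun n _ => this n).trans ?_
    simp [mul_comm]

end Policy

theorem mem_Icc_of_feasibleRates {abar : Fin K → ℝ} (h : abar ∈ N.feasibleRates) (k : Fin K) :
    abar k ∈ Set.Icc 0 N.Amax := by
  obtain ⟨S, _, σ, _, p, hp⟩ := h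
  exact hp.mem_Icc k

/-! ### Supporting hyperplanes of the feasible rates -/

section
variable {R : ℝ} (hR : ∀ᵐ h ∂N.chan, ∀ w ∈ N.powerSet, ∀ k, N.rate h w k ≤ R)
include hR

/-- Places feasible rates in the interval where curvature is controlled. The common bound `R` on all
policies makes the real supremum a genuine one. -/
theorem le_maxAvgRate (hR0 : 0 ≤ R) {abar : Fin K → ℝ} (h : abar ∈ N.feasibleRates)
    (k : Fin K) : abar k ≤ N.maxAvgRate := by
  obtain ⟨S, hS, σ, hσ, p, hp⟩ := h
  refine (hp.le_rate k).trans (le_csSup ⟨R, ?_⟩ ⟨S, hS, σ, hσ, p, abar, k, hp, rfl⟩)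
  rintro x ⟨S', _, σ', _, p', _, k', _, rfl⟩
  exact p'.avgRate_le σ' hR hR0 k'

theorem integrable_maxWeighted {q : Fin K → ℝ} (hq : ∀ k, 0 ≤ q k) :
    Integrable (N.maxWeighted q) N.chan := by
  have := N.chan_prob
  have hm : Measurable (N.maxWeighted q) :=
    Measurable.uncurry_comp measurable_maxWeighted measurable_const measurable_id
  refine Integrable.of_bound hm.aestronglyMeasurable (∑ k, q k * R) ?_
  filter_upwards [hR] with h hh
  rw [Real.norm_of_nonneg (maxWeighted_nonneg hq h)]
  exact maxWeighted_le_of_rate_le hq hh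

/-- The mean of the largest weighted sum rate supports the feasible rates. -/
theorem weighted_le_integral_maxWeighted {abar : Fin K → ℝ}
    (h : abar ∈ N.feasibleRates) {q : Fin K → ℝ} (hq : ∀ k, 0 ≤ q k) :
    ∑ k, q k * abar k ≤ ∫ h, N.maxWeighted q h ∂N.chan := by
  obtain ⟨S, hS, σ, hσ, p, hp⟩ := h
  have hslot : ∀ n, ∑ k, q k * ∫ ω, p.r n ω k ∂(N.prob σ) ≤ ∫ h, N.maxWeighted q h ∂N.chan := by
    intro n
    have hint := integrable_maxWeighted hR hq
    have hmp := measurePreserving_channel (N := N) σ n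
    have e : ∫ h, N.maxWeighted q h ∂N.chan = ∫ ω, N.maxWeighted q (ω.2.1 n) ∂(N.prob σ) := by
      rw [← hmp.map_eq, integral_map hmp.measurable.aemeasurable]
      rw [hmp.map_eq]
      exact hint.aestronglyMeasurable
    rw [e]
    have hi : ∀ k ∈ Finset.univ, Integrable (fun ω => q k * p.r n ω k) (N.prob σ) :=
      fun k _ => (p.integrable_r σ hR n k).const_mul (q k)
    calc ∑ k, q k * ∫ ω, p.r n ω k ∂(N.prob σ) = ∫ ω, ∑ k, q k * p.r n ω k ∂(N.prob σ) := by
          rw [integral_finsetSum _ hi]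
          simp only [integral_const_mul]
      _ ≤ _ := by
          refine integral_mono_ae (integrable_finsetSum _ hi) (hmp.integrable_comp_of_integrable hint) ?_
          filter_upwards [Policy.ae_rate_le σ hR n] with ω hω
          exact weighted_le_maxWeighted hq hω (p.w_mem n ω)
  -- Each liminf holds per flow, so one horizon `T` is taken that serves all flows up to a margin of
  -- weighted total at most `ε`. The `+ 1` covers `q = 0`.
  refine le_of_forall_pos_le_add fun ε hε => ?_
  have hs : 0 < ∑ k, q k + 1 := by
    have := Finset.sum_nonneg fun k (_ : k ∈ Finset.univ) => hq k
    linarith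
  have hev : ∀ᶠ T : ℕ in atTop, ∀ k, abar k - ε / (∑ k, q k + 1) <
      (∑ n ∈ Finset.range T, ∫ ω, p.r n ω k ∂(N.prob σ)) / T := by
    rw [eventually_all]
    intro k
    refine eventually_lt_of_lt_liminf ?_ (p.isBoundedUnder_average_r σ k)
    have := hp.le_rate k
    have h2 : 0 < ε / (∑ k, q k + 1) := by positivity
    exact lt_of_lt_of_le (by linarith) this
  obtain ⟨T, hT, hT0⟩ := (hev.and (eventually_gt_atTop 0)).exists
  have hT0' : (0 : ℝ) < T := Nat.cast_pos.2 hT0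
  have h1 : ∑ k, q k * (abar k - ε / (∑ k, q k + 1)) ≤
      ∑ k, q k * ((∑ n ∈ Finset.range T, ∫ ω, p.r n ω k ∂(N.prob σ)) / T) :=
    Finset.sum_le_sum fun k _ => mul_le_mul_of_nonneg_left (hT k).le (hq k)
  have h2 : ∑ k, q k * ((∑ n ∈ Finset.range T, ∫ ω, p.r n ω k ∂(N.prob σ)) / T) =
      (∑ n ∈ Finset.range T, ∑ k, q k * ∫ ω, p.r n ω k ∂(N.prob σ)) / T := by
    rw [Finset.sum_comm, Finset.sum_div]
    exact Finset.sum_congr rfl fun k _ => by rw [← mul_div_assoc, Finset.mul_sum]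
  have h3 : (∑ n ∈ Finset.range T, ∑ k, q k * ∫ ω, p.r n ω k ∂(N.prob σ)) / T ≤
      ∫ h, N.maxWeighted q h ∂N.chan := by
    rw [div_le_iff₀ hT0']
    refine (Finset.sum_le_sum fun n _ => hslot n).trans ?_
    simp [mul_comm]
  have h4 : ∑ k, q k * (abar k - ε / (∑ k, q k + 1)) =
      ∑ k, q k * abar k - ε * ((∑ k, q k) / (∑ k, q k + 1)) := by
    simp only [mul_sub, Finset.sum_sub_distrib, ← Finset.sum_mul]
    ring
  have h5 : (∑ k, q k) / (∑ k, q k + 1) ≤ 1 := by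
    rw [div_le_one hs]; linarith
  nlinarith
end

end Network

namespace Network

variable {K J : ℕ} {N : Network K J} {S : Type} [MeasurableSpace S]

/-! ### Drift of the algorithm -/

/-- Deterministic bound on the auxiliary queue of a flow with utility `U`. -/
def queueBound (N : Network K J) (U : ℝ → ℝ) (φ : ℝ) : ℝ :=
  marginal U 0 * (φ * N.τ) + N.Amax * N.τ

/-- Lyapunov function of one auxiliary queue. -/
def lyapunov (N : Network K J) (R q : ℝ) : ℝ :=
  q ^ 2 / 2 + (R - N.Amax) / 2 * N.τ * q

theorem measurable_lyapunov (R : ℝ) : Measurable (N.lyapunov R) := by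
  unfold lyapunov
  fun_prop

theorem abs_lyapunov_le {R q b : ℝ} (hq : 0 ≤ q) (hqb : q ≤ b) :
    |N.lyapunov R q| ≤ b ^ 2 / 2 + |R - N.Amax| / 2 * N.τ * b := by
  have hτ := N.τ_pos
  unfold lyapunov
  refine (abs_add_le _ _).trans (add_le_add ?_ ?_)
  · rw [abs_of_nonneg (by positivity)]
    gcongr
  · rw [abs_mul, abs_mul, abs_div, abs_of_nonneg hq, abs_of_pos hτ, abs_two]
    gcongr

variable {U : Fin K → ℝ → ℝ} {ψ Ψ rbar φ R : ℝ} {σ : Measure S} {p : N.Policy S}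

theorem queueBound_nonneg (hU : ∀ k, UtilityOK (U k) ψ Ψ rbar) (hφ : 0 < φ) (k : Fin K) :
    0 ≤ N.queueBound (U k) φ := by
  have := (hU k).marginal_nonneg 0
  have h1 := N.τ_pos
  have h2 := N.Amax_pos
  unfold queueBound
  positivity

/-- At or above `U'(0) φτ` admission stops, and below it one slot adds at most `Amax τ`. -/
theorem IsAlgorithmRun.auxQueue_le (hp : IsAlgorithmRun U φ σ p)
    (hU : ∀ k, UtilityOK (U k) ψ Ψ rbar) (hφ : 0 < φ) (n : ℕ) (ω : N.Sample S) (k : Fin K) :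
    p.auxQueue n ω k ≤ N.queueBound (U k) φ := by
  have hτ := N.τ_pos
  induction n with
  | zero => exact queueBound_nonneg hU hφ k
  | succ n ih =>
    rw [Policy.auxQueue_succ]
    refine max_le (queueBound_nonneg hU hφ k) ?_
    have hr := mul_nonneg (p.r_nonneg n ω k) hτ.le
    rcases le_total (marginal (U k) 0) (p.auxQueue n ω k / (φ * N.τ)) with h | h
    · rw [hp.congestion, (hU k).congestionRate_of_ge N.Amax_pos.le h]
      linarith
    · rw [div_le_iff₀ (by positivity)] at h
      have := mul_le_mul_of_nonneg_right (p.a_le n ω k) hτ.le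
      unfold queueBound
      linarith

theorem ae_drift_le [IsProbabilityMeasure σ]
    (hR : ∀ᵐ h ∂N.chan, ∀ w ∈ N.powerSet, ∀ k, N.rate h w k ≤ R) (n : ℕ) :
    ∀ᵐ ω ∂(N.prob σ), ∀ k, N.lyapunov R (p.auxQueue (n + 1) ω k) ≤
      N.lyapunov R (p.auxQueue n ω k) +
        N.τ * (p.auxQueue n ω k * (p.a n ω k - p.r n ω k)) +
        N.τ ^ 2 / 4 * (N.Amax ^ 2 + R ^ 2) := by
  filter_upwards [p.ae_r_le σ hR n] with ω hω k
  exact queue_drift_le N.τ_pos (p.auxQueue_nonneg n ω k) (p.a_mem n ω k)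
    ⟨p.r_nonneg n ω k, hω k⟩

/-- The event that the beamformer of slot `n` does not maximize the weighted sum rate over the
whole instantaneous achievable rate region. -/
def bindingSet (p : N.Policy S) (n : ℕ) : Set (N.Sample S) :=
  {ω | ¬ IsMaxOn (N.weightedRate (p.auxQueue n ω) (ω.2.1 n)) N.powerSet (p.w n ω)}

theorem weightedRate_eq (q : Fin K → ℝ) (h : Channel K J N.M) (v : Beam K J N.M) :
    N.weightedRate q h v = (∑ k, q k * N.rate h v k) / N.τ := by
  rw [weightedRate, Finset.sum_div]
  exact Finset.sum_congr rfl fun k _ => by ring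

/-- Where the delay constraint costs nothing the scheduler attains the maximum; elsewhere the
bounded queues limit the loss. The measurable hull stands in for the exceptional event, whose
measurability is not established. -/
theorem IsAlgorithmRun.ae_maxWeighted_le [IsProbabilityMeasure σ] (hp : IsAlgorithmRun U φ σ p)
    (hU : ∀ k, UtilityOK (U k) ψ Ψ rbar) (hφ : 0 < φ) (hR0 : 0 ≤ R)
    (hR : ∀ᵐ h ∂N.chan, ∀ w ∈ N.powerSet, ∀ k, N.rate h w k ≤ R) (n : ℕ) :
    ∀ᵐ ω ∂(N.prob σ), N.maxWeighted (p.auxQueue n ω) (ω.2.1 n) ≤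
      ∑ k, p.auxQueue n ω k * p.r n ω k +
        (toMeasurable (N.prob σ) (bindingSet p n)).indicator
          (fun _ => ∑ k, N.queueBound (U k) φ * R) ω := by
  filter_upwards [Policy.ae_rate_le σ hR n] with ω hω
  have hB : 0 ≤ ∑ k, N.queueBound (U k) φ * R :=
    Finset.sum_nonneg fun k _ => mul_nonneg (queueBound_nonneg hU hφ k) hR0
  by_cases hb : ω ∈ bindingSet p n
  · rw [Set.indicator_of_mem (subset_toMeasurable _ _ hb)]
    have h1 := maxWeighted_le_of_rate_le (p.auxQueue_nonneg n ω) hω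
    have h2 : ∑ k, p.auxQueue n ω k * R ≤ ∑ k, N.queueBound (U k) φ * R :=
      Finset.sum_le_sum fun k _ => mul_le_mul_of_nonneg_right (hp.auxQueue_le hU hφ n ω k) hR0
    have h3 : 0 ≤ ∑ k, p.auxQueue n ω k * p.r n ω k :=
      Finset.sum_nonneg fun k _ => mul_nonneg (p.auxQueue_nonneg n ω k) (p.r_nonneg n ω k)
    linarith
  · have hmax : IsMaxOn (N.weightedRate (p.auxQueue n ω) (ω.2.1 n)) N.powerSet (p.w n ω) :=
      not_not.1 hb
    have h1 : N.maxWeighted (p.auxQueue n ω) (ω.2.1 n) ≤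
        ∑ k, p.auxQueue n ω k * p.r n ω k := by
      refine maxWeighted_le fun v hv => ?_
      have := isMaxOn_iff.1 hmax v hv
      rw [weightedRate_eq, weightedRate_eq, div_le_div_iff_of_pos_right N.τ_pos] at this
      exact this
    have h2 := Set.indicator_nonneg (s := toMeasurable (N.prob σ) (bindingSet p n))
      (f := fun _ => ∑ k, N.queueBound (U k) φ * R) (fun _ _ => hB) ω
    linarith

theorem integrable_of_measurable_of_abs_le {Ω : Type*} [MeasurableSpace Ω] {μ : Measure Ω}
    [IsFiniteMeasure μ] {f : Ω → ℝ} (hf : Measurable f) {C : ℝ} (hC : ∀ ω, |f ω| ≤ C) :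
    Integrable f μ :=
  Integrable.of_bound hf.aestronglyMeasurable C (ae_of_all _ hC)

theorem integral_le_of_ae_affine_le {Ω : Type*} [MeasurableSpace Ω] {μ : Measure Ω}
    [IsProbabilityMeasure μ] {f g₁ g₂ g₃ g₄ : Ω → ℝ} (hf : Integrable f μ) (h₁ : Integrable g₁ μ)
    (h₂ : Integrable g₂ μ) (h₃ : Integrable g₃ μ) (h₄ : Integrable g₄ μ) {t c : ℝ}
    (h : ∀ᵐ ω ∂μ, t * f ω ≤ ((g₁ ω - g₂ ω) + t * g₃ ω) + (t * g₄ ω + c)) :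
    t * ∫ ω, f ω ∂μ ≤
      ((∫ ω, g₁ ω ∂μ - ∫ ω, g₂ ω ∂μ) + t * ∫ ω, g₃ ω ∂μ) + (t * ∫ ω, g₄ ω ∂μ + c) := by
  have i12 : Integrable (fun ω => g₁ ω - g₂ ω) μ := h₁.sub h₂
  have i3 : Integrable (fun ω => t * g₃ ω) μ := h₃.const_mul t
  have i4 : Integrable (fun ω => t * g₄ ω) μ := h₄.const_mul t
  have i123 : Integrable (fun ω => (g₁ ω - g₂ ω) + t * g₃ ω) μ := i12.add i3
  have i45 : Integrable (fun ω => t * g₄ ω + c) μ := i4.add (integrable_const c)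
  calc t * ∫ ω, f ω ∂μ = ∫ ω, t * f ω ∂μ := (integral_const_mul _ _).symm
    _ ≤ ∫ ω, ((g₁ ω - g₂ ω) + t * g₃ ω) + (t * g₄ ω + c) ∂μ :=
        integral_mono_ae (hf.const_mul t) (i123.add i45) h
    _ = _ := by
        rw [integral_add i123 i45, integral_add i12 i3, integral_sub h₁ h₂,
          integral_add i4 (integrable_const c), integral_const_mul, integral_const_mul,
          integral_const]
        simp

theorem measurable_auxQueue_apply' (p : N.Policy S) (n : ℕ) (k : Fin K) :
    Measurable fun ω => p.auxQueue n ω k :=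
  (p.measurable_auxQueue_apply n k).mono (info_le _) le_rfl

theorem measurable_a_apply' (p : N.Policy S) (n : ℕ) (k : Fin K) :
    Measurable fun ω => p.a n ω k :=
  (p.measurable_a_apply n k).mono (info_le _) le_rfl

section
variable [IsProbabilityMeasure σ] (hp : IsAlgorithmRun U φ σ p)
  (hU : ∀ k, UtilityOK (U k) ψ Ψ rbar) (hφ : 0 < φ)
include hp hU hφ

theorem IsAlgorithmRun.integrable_auxQueue (n : ℕ) (k : Fin K) :
    Integrable (fun ω => p.auxQueue n ω k) (N.prob σ) := by
  refine integrable_of_measurable_of_abs_le (measurable_auxQueue_apply' p n k)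
    (C := N.queueBound (U k) φ) fun ω => ?_
  rw [abs_of_nonneg (p.auxQueue_nonneg n ω k)]
  exact hp.auxQueue_le hU hφ n ω k

theorem IsAlgorithmRun.integrable_lyapunov (n : ℕ) (k : Fin K) :
    Integrable (fun ω => N.lyapunov R (p.auxQueue n ω k)) (N.prob σ) :=
  integrable_of_measurable_of_abs_le
    ((measurable_lyapunov R).comp (measurable_auxQueue_apply' p n k))
    fun ω => abs_lyapunov_le (p.auxQueue_nonneg n ω k) (hp.auxQueue_le hU hφ n ω k)

theorem IsAlgorithmRun.integrable_auxQueue_mul (n : ℕ) (k : Fin K) :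
    Integrable (fun ω => p.auxQueue n ω k * p.a n ω k) (N.prob σ) := by
  refine integrable_of_measurable_of_abs_le
    ((measurable_auxQueue_apply' p n k).mul (measurable_a_apply' p n k))
    (C := N.queueBound (U k) φ * N.Amax) fun ω => ?_
  rw [abs_of_nonneg (mul_nonneg (p.auxQueue_nonneg n ω k) (p.a_nonneg n ω k))]
  exact mul_le_mul (hp.auxQueue_le hU hφ n ω k) (p.a_le n ω k) (p.a_nonneg n ω k)
    (queueBound_nonneg hU hφ k)

variable (hR0 : 0 ≤ R) (hR : ∀ᵐ h ∂N.chan, ∀ w ∈ N.powerSet, ∀ k, N.rate h w k ≤ R)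
include hR0 hR

theorem IsAlgorithmRun.integrable_maxWeighted (n : ℕ) :
    Integrable (fun ω => N.maxWeighted (p.auxQueue n ω) (ω.2.1 n)) (N.prob σ) := by
  have hm : Measurable fun ω : N.Sample S => N.maxWeighted (p.auxQueue n ω) (ω.2.1 n) :=
    Measurable.uncurry_comp measurable_maxWeighted
      (measurable_pi_lambda _ (measurable_auxQueue_apply' p n)) (by fun_prop)
  refine Integrable.of_bound hm.aestronglyMeasurable (∑ k, N.queueBound (U k) φ * R) ?_
  filter_upwards [Policy.ae_rate_le σ hR n] with ω hω
  rw [Real.norm_of_nonneg (maxWeighted_nonneg (p.auxQueue_nonneg n ω) _)]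
  refine (maxWeighted_le_of_rate_le (p.auxQueue_nonneg n ω) hω).trans ?_
  exact Finset.sum_le_sum fun k _ =>
    mul_le_mul_of_nonneg_right (hp.auxQueue_le hU hφ n ω k) hR0

/-- The scheduler's objective dominates any feasible rate vector, because the channel is
independent of the queues. -/
theorem IsAlgorithmRun.integral_weighted_le {y : Fin K → ℝ} (hy : y ∈ N.feasibleRates) (n : ℕ) :
    ∫ ω, ∑ k, p.auxQueue n ω k * y k ∂(N.prob σ) ≤
      ∫ ω, N.maxWeighted (p.auxQueue n ω) (ω.2.1 n) ∂(N.prob σ) := by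
  have := N.chan_prob
  have hq : Measurable (p.auxQueue n) :=
    measurable_pi_lambda _ (measurable_auxQueue_apply' p n)
  have hmp := measurePreserving_channel (N := N) σ n
  have hpair : Measurable fun ω : N.Sample S => (p.auxQueue n ω, ω.2.1 n) :=
    hq.prodMk hmp.measurable
  -- By independence the joint law is a product, so Fubini freezes the queues and the supporting
  -- inequality applies for each fixed weight vector.
  have hlaw : (N.prob σ).map (fun ω => (p.auxQueue n ω, ω.2.1 n)) =
      ((N.prob σ).map (p.auxQueue n)).prod N.chan := by
    have h := (ProbabilityTheory.indepFun_iff_map_prod_eq_prod_map_map hq.aemeasurable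
      hmp.measurable.aemeasurable).1 (indepFun_channel σ n (p.measurable_auxQueue n))
    rw [h, hmp.map_eq]
  have : IsProbabilityMeasure ((N.prob σ).map (p.auxQueue n)) :=
    Measure.isProbabilityMeasure_map hq.aemeasurable
  have hsm : StronglyMeasurable fun x : (Fin K → ℝ) × Channel K J N.M =>
      N.maxWeighted x.1 x.2 := measurable_maxWeighted.stronglyMeasurable
  have hint : Integrable (fun x : (Fin K → ℝ) × Channel K J N.M => N.maxWeighted x.1 x.2)
      (((N.prob σ).map (p.auxQueue n)).prod N.chan) := by
    rw [← hlaw, integrable_map_measure hsm.aestronglyMeasurable hpair.aemeasurable]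
    exact hp.integrable_maxWeighted hU hφ hR0 hR n
  have hint2 := hint.integral_prod_left
  rw [integrable_map_measure hint2.aestronglyMeasurable hq.aemeasurable] at hint2
  have e : ∫ ω, N.maxWeighted (p.auxQueue n ω) (ω.2.1 n) ∂(N.prob σ) =
      ∫ ω, (∫ h, N.maxWeighted (p.auxQueue n ω) h ∂N.chan) ∂(N.prob σ) := by
    have e1 := integral_map (μ := N.prob σ) hpair.aemeasurable
      (f := fun x : (Fin K → ℝ) × Channel K J N.M => N.maxWeighted x.1 x.2)
      hsm.aestronglyMeasurable
    rw [hlaw, integral_prod _ hint,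
      integral_map hq.aemeasurable hint.integral_prod_left.aestronglyMeasurable] at e1
    exact e1.symm
  rw [e]
  refine integral_mono (integrable_finsetSum _ fun k _ =>
    (hp.integrable_auxQueue hU hφ n k).mul_const (y k)) hint2 fun ω => ?_
  exact weighted_le_integral_maxWeighted hR hy (p.auxQueue_nonneg n ω)

/-- The drift bounds the weighted service from above, and the scheduler bounds it from below by what
any feasible `y` would earn. -/
theorem IsAlgorithmRun.integral_drift_le {y : Fin K → ℝ} (hy : y ∈ N.feasibleRates) (n : ℕ) :
    ∫ ω, ∑ k, p.auxQueue n ω k * (y k - p.a n ω k) ∂(N.prob σ) ≤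
      ((∫ ω, ∑ k, N.lyapunov R (p.auxQueue n ω k) ∂(N.prob σ)) -
        ∫ ω, ∑ k, N.lyapunov R (p.auxQueue (n + 1) ω k) ∂(N.prob σ)) / N.τ +
      K * (N.τ / 4 * (N.Amax ^ 2 + R ^ 2)) +
      (N.prob σ).real (bindingSet p n) * ∑ k, N.queueBound (U k) φ * R := by
  have hτ := N.τ_pos
  have iL : ∀ m, Integrable (fun ω => ∑ k, N.lyapunov R (p.auxQueue m ω k)) (N.prob σ) :=
    fun m => integrable_finsetSum _ fun k _ => hp.integrable_lyapunov hU hφ m k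
  have iY : Integrable (fun ω => ∑ k, p.auxQueue n ω k * y k) (N.prob σ) :=
    integrable_finsetSum _ fun k _ => (hp.integrable_auxQueue hU hφ n k).mul_const (y k)
  have iA : Integrable (fun ω => ∑ k, p.auxQueue n ω k * p.a n ω k) (N.prob σ) :=
    integrable_finsetSum _ fun k _ => hp.integrable_auxQueue_mul hU hφ n k
  have iM := hp.integrable_maxWeighted hU hφ hR0 hR n
  have hms := measurableSet_toMeasurable (N.prob σ) (bindingSet p n)
  set C := ∑ k, N.queueBound (U k) φ * R with hC
  have iB : Integrable ((toMeasurable (N.prob σ) (bindingSet p n)).indicator fun _ => C)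
      (N.prob σ) := (integrable_const C).indicator hms
  have eB : ∫ ω, (toMeasurable (N.prob σ) (bindingSet p n)).indicator (fun _ => C) ω
      ∂(N.prob σ) = (N.prob σ).real (bindingSet p n) * C := by
    rw [integral_indicator_const C hms, smul_eq_mul, Measure.real, Measure.real,
      measure_toMeasurable]
  have hae : ∀ᵐ ω ∂(N.prob σ), N.τ * N.maxWeighted (p.auxQueue n ω) (ω.2.1 n) ≤
      (((∑ k, N.lyapunov R (p.auxQueue n ω k)) -
        ∑ k, N.lyapunov R (p.auxQueue (n + 1) ω k)) +
        N.τ * ∑ k, p.auxQueue n ω k * p.a n ω k) +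
      (N.τ * (toMeasurable (N.prob σ) (bindingSet p n)).indicator (fun _ => C) ω +
        K * (N.τ ^ 2 / 4 * (N.Amax ^ 2 + R ^ 2))) := by
    filter_upwards [ae_drift_le (p := p) hR n, hp.ae_maxWeighted_le hU hφ hR0 hR n] with ω h1 h2
    have h3 := Finset.sum_le_sum fun k (_ : k ∈ Finset.univ) => h1 k
    simp only [mul_sub, Finset.sum_add_distrib, Finset.sum_sub_distrib, ← Finset.mul_sum,
      Finset.sum_const, Finset.card_univ, Fintype.card_fin, nsmul_eq_mul] at h3
    have h4 := mul_le_mul_of_nonneg_left h2 hτ.le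
    linarith
  have hI := integral_le_of_ae_affine_le iM (iL n) (iL (n + 1)) iA iB hae
  rw [eB] at hI
  have hY := mul_le_mul_of_nonneg_left (hp.integral_weighted_le hU hφ hR0 hR hy n) hτ.le
  have e0 : ∫ ω, ∑ k, p.auxQueue n ω k * (y k - p.a n ω k) ∂(N.prob σ) =
      (∫ ω, ∑ k, p.auxQueue n ω k * y k ∂(N.prob σ)) -
        ∫ ω, ∑ k, p.auxQueue n ω k * p.a n ω k ∂(N.prob σ) := by
    rw [← integral_sub iY iA]
    simp only [mul_sub, Finset.sum_sub_distrib]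
  rw [e0, ← mul_le_mul_iff_right₀ hτ]
  have e1 : ∀ x z : ℝ, N.τ * ((x / N.τ) + K * (N.τ / 4 * (N.Amax ^ 2 + R ^ 2)) + z) =
      x + K * (N.τ ^ 2 / 4 * (N.Amax ^ 2 + R ^ 2)) + N.τ * z := by
    intro x z
    field_simp
  rw [e1]
  linarith
end

end Network

namespace Network

variable {K J : ℕ} {N : Network K J} {S : Type} [MeasurableSpace S]
  {U : Fin K → ℝ → ℝ} {ψ Ψ rbar φ R : ℝ} {σ : Measure S} {p : N.Policy S}

/-! ### Steady state -/

theorem IsSteadyState.tendsto {ρ : Measure (Fin K → ℝ)} (hρ : IsSteadyState σ p ρ)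
    {f : (Fin K → ℝ) → ℝ} (hf : Continuous f) {C : ℝ} (hC : ∀ q, |f q| ≤ C) :
    Tendsto (fun T : ℕ => (∑ n ∈ Finset.range T, ∫ ω, f (p.auxQueue n ω) ∂(N.prob σ)) / T)
      atTop (𝓝 (∫ q, f q ∂ρ)) :=
  hρ.2 (BoundedContinuousFunction.ofNormedAddCommGroup f hf C hC)

theorem continuous_congestionRate_apply (hU : ∀ k, UtilityOK (U k) ψ Ψ rbar) (k : Fin K) :
    Continuous fun q : Fin K → ℝ => congestionRate (U k) N.Amax (q k / (φ * N.τ)) :=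
  ((hU k).continuous_congestionRate N.Amax_pos.le).comp ((continuous_apply k).div_const _)

theorem abs_congestionRate_le (hU : ∀ k, UtilityOK (U k) ψ Ψ rbar) (k : Fin K) (y : ℝ) :
    |congestionRate (U k) N.Amax y| ≤ N.Amax := by
  have h := (hU k).congestionRate_mem N.Amax_pos.le y
  rw [abs_of_nonneg h.1]
  exact h.2

theorem integrable_congestionRate (hU : ∀ k, UtilityOK (U k) ψ Ψ rbar)
    {ρ : Measure (Fin K → ℝ)} [IsProbabilityMeasure ρ] (k : Fin K) :
    Integrable (fun q : Fin K → ℝ => congestionRate (U k) N.Amax (q k / (φ * N.τ))) ρ :=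
  integrable_of_measurable_of_abs_le (continuous_congestionRate_apply hU k).measurable
    fun _ => abs_congestionRate_le hU k _

theorem abs_clip_le {b : ℝ} (hb : 0 ≤ b) (q : ℝ) : |max 0 (min q b)| ≤ b := by
  rw [abs_of_nonneg (le_max_left _ _)]
  exact max_le hb (min_le_right _ _)

/-- The gap between a rate vector `y` and the congestion control rates, weighted by the (clipped)
auxiliary queues. -/
def weightedGap (N : Network K J) (U : Fin K → ℝ → ℝ) (φ : ℝ) (y q : Fin K → ℝ) : ℝ :=
  ∑ k, max 0 (min (q k) (N.queueBound (U k) φ)) *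
    (y k - congestionRate (U k) N.Amax (q k / (φ * N.τ)))

theorem continuous_weightedGap (hU : ∀ k, UtilityOK (U k) ψ Ψ rbar) (y : Fin K → ℝ) :
    Continuous (N.weightedGap U φ y) := by
  refine continuous_finsetSum _ fun k _ => Continuous.mul (by fun_prop)
    (continuous_const.sub (continuous_congestionRate_apply hU k))

theorem abs_weightedGap_le (hU : ∀ k, UtilityOK (U k) ψ Ψ rbar) (hφ : 0 < φ) {y : Fin K → ℝ}
    (hy : ∀ k, y k ∈ Set.Icc 0 N.Amax) (q : Fin K → ℝ) :
    |N.weightedGap U φ y q| ≤ ∑ k, N.queueBound (U k) φ * N.Amax := by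
  refine (Finset.abs_sum_le_sum_abs _ _).trans (Finset.sum_le_sum fun k _ => ?_)
  rw [abs_mul]
  refine mul_le_mul (abs_clip_le (queueBound_nonneg hU hφ k) _) ?_ (abs_nonneg _)
    (queueBound_nonneg hU hφ k)
  have h := (hU k).congestionRate_mem N.Amax_pos.le (q k / (φ * N.τ))
  rw [abs_le]
  exact ⟨by linarith [(hy k).1, h.2], by linarith [(hy k).2, h.1]⟩

/-! ### Long-run averages of the drift inequality -/

section
variable [IsProbabilityMeasure σ] (hp : IsAlgorithmRun U φ σ p)
  (hU : ∀ k, UtilityOK (U k) ψ Ψ rbar) (hφ : 0 < φ)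
include hp hU hφ

omit [IsProbabilityMeasure σ] in
theorem IsAlgorithmRun.weightedGap_auxQueue (y : Fin K → ℝ) (n : ℕ) (ω : N.Sample S) :
    N.weightedGap U φ y (p.auxQueue n ω) =
      ∑ k, p.auxQueue n ω k * (y k - p.a n ω k) := by
  refine Finset.sum_congr rfl fun k _ => ?_
  rw [hp.congestion n ω k, min_eq_left (hp.auxQueue_le hU hφ n ω k),
    max_eq_right (p.auxQueue_nonneg n ω k)]

variable (hR0 : 0 ≤ R) (hR : ∀ᵐ h ∂N.chan, ∀ w ∈ N.powerSet, ∀ k, N.rate h w k ≤ R)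
include hR0 hR

omit hR0 in
-- Dropping the truncation at `0` gives `a - r ≤ (q̂[n+1] - q̂[n])/τ`. This telescopes, and bounded
-- queues make the averaged excess `O(1/T)`.
theorem IsAlgorithmRun.feasible (hstable : p.Stable σ) {ρ : Measure (Fin K → ℝ)}
    (hρ : IsSteadyState σ p ρ) : p.Feasible σ (N.meanRate U φ ρ) := by
  have hτ := N.τ_pos
  have havg : ∀ k, Tendsto
      (fun T : ℕ => (∑ n ∈ Finset.range T, ∫ ω, p.a n ω k ∂(N.prob σ)) / T) atTop
      (𝓝 (N.meanRate U φ ρ k)) := by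
    intro k
    have := hρ.tendsto (continuous_congestionRate_apply (N := N) (φ := φ) hU k)
      (fun q => abs_congestionRate_le hU k _)
    simp only [← hp.congestion] at this
    exact this
  refine ⟨havg, hstable, hp.delay, fun k => ?_⟩
  have hslot : ∀ n, (∫ ω, p.a n ω k ∂(N.prob σ)) - ∫ ω, p.r n ω k ∂(N.prob σ) ≤
      ((∫ ω, p.auxQueue (n + 1) ω k ∂(N.prob σ)) - ∫ ω, p.auxQueue n ω k ∂(N.prob σ)) / N.τ := by
    intro n
    have ia := p.integrable_a σ n k
    have ir := p.integrable_r σ hR n k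
    have iq := hp.integrable_auxQueue hU hφ n k
    have iq' := hp.integrable_auxQueue hU hφ (n + 1) k
    rw [← integral_sub ia ir, ← integral_sub iq' iq, ← integral_div]
    refine integral_mono (ia.sub ir) ((iq'.sub iq).div_const _) fun ω => ?_
    rw [le_div_iff₀ hτ, Policy.auxQueue_succ]
    linarith [le_max_right 0 (p.auxQueue n ω k + p.a n ω k * N.τ - p.r n ω k * N.τ)]
  have hsum : ∀ T : ℕ, (∑ n ∈ Finset.range T, ∫ ω, p.a n ω k ∂(N.prob σ)) / T -
      N.queueBound (U k) φ / N.τ / T ≤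
      (∑ n ∈ Finset.range T, ∫ ω, p.r n ω k ∂(N.prob σ)) / T := by
    intro T
    have h1 := Finset.sum_le_sum fun n (_ : n ∈ Finset.range T) => hslot n
    rw [Finset.sum_sub_distrib, ← Finset.sum_div, Finset.sum_range_sub
      (fun n => ∫ ω, p.auxQueue n ω k ∂(N.prob σ))] at h1
    have h2 : ∫ ω, p.auxQueue T ω k ∂(N.prob σ) ≤ N.queueBound (U k) φ :=
      (integral_mono (hp.integrable_auxQueue hU hφ T k) (integrable_const _)
        fun ω => hp.auxQueue_le hU hφ T ω k).trans_eq (by simp)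
    have h3 : 0 ≤ ∫ ω, p.auxQueue 0 ω k ∂(N.prob σ) :=
      integral_nonneg fun ω => p.auxQueue_nonneg 0 ω k
    have h4 : ((∫ ω, p.auxQueue T ω k ∂(N.prob σ)) - ∫ ω, p.auxQueue 0 ω k ∂(N.prob σ)) / N.τ ≤
        N.queueBound (U k) φ / N.τ := by
      gcongr
      linarith
    rw [← sub_div]
    gcongr
    linarith
  have hlim : Tendsto (fun T : ℕ => (∑ n ∈ Finset.range T, ∫ ω, p.a n ω k ∂(N.prob σ)) / T -
      N.queueBound (U k) φ / N.τ / T) atTop (𝓝 (N.meanRate U φ ρ k)) := by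
    simpa using (havg k).sub (tendsto_const_div_atTop_nhds_zero_nat (N.queueBound (U k) φ / N.τ))
  rw [← hlim.liminf_eq]
  have hR0' : 0 ≤ max 0 R := le_max_left _ _
  have hR' : ∀ᵐ h ∂N.chan, ∀ w ∈ N.powerSet, ∀ k, N.rate h w k ≤ max 0 R := by
    filter_upwards [hR] with h hh w hw k using (hh w hw k).trans (le_max_right _ _)
  exact liminf_le_liminf (Eventually.of_forall hsum) hlim.isBoundedUnder_ge
    (p.isCoboundedUnder_average_r σ hR' hR0' k)

/-- After division by `T` the telescoped Lyapunov terms vanish because they are bounded, and the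
exceptional slots vanish by slackness. Only the drift constant survives. -/
theorem IsAlgorithmRun.integral_weightedGap_le (hslack : DelaySlack σ p)
    {ρ : Measure (Fin K → ℝ)} (hρ : IsSteadyState σ p ρ) {y : Fin K → ℝ}
    (hy : y ∈ N.feasibleRates) :
    ∫ q, N.weightedGap U φ y q ∂ρ ≤ K * (N.τ / 4 * (N.Amax ^ 2 + R ^ 2)) := by
  have hτ := N.τ_pos
  set L : ℕ → ℝ := fun n => ∫ ω, ∑ k, N.lyapunov R (p.auxQueue n ω k) ∂(N.prob σ) with hL
  set C := ∑ k, N.queueBound (U k) φ * R with hC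
  set D := ∑ k, (N.queueBound (U k) φ ^ 2 / 2 +
    |R - N.Amax| / 2 * N.τ * N.queueBound (U k) φ) with hD
  have hLD : ∀ n, |L n| ≤ D := by
    intro n
    have hb : ∀ ω, ‖∑ k, N.lyapunov R (p.auxQueue n ω k)‖ ≤ D := fun ω =>
      (Finset.abs_sum_le_sum_abs _ _).trans (Finset.sum_le_sum fun k _ =>
        abs_lyapunov_le (p.auxQueue_nonneg n ω k) (hp.auxQueue_le hU hφ n ω k))
    have := norm_integral_le_of_norm_le_const (μ := N.prob σ) (ae_of_all _ hb)
    simpa using this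
  have hlim := hρ.tendsto (continuous_weightedGap (N := N) (φ := φ) hU y)
    (abs_weightedGap_le hU hφ (mem_Icc_of_feasibleRates hy))
  have hdrift : ∀ n, ∫ ω, ∑ k, p.auxQueue n ω k * (y k - p.a n ω k) ∂(N.prob σ) ≤
      (L n - L (n + 1)) / N.τ + K * (N.τ / 4 * (N.Amax ^ 2 + R ^ 2)) +
        (N.prob σ).real (bindingSet p n) * C :=
    fun n => hp.integral_drift_le hU hφ hR0 hR hy n
  clear_value C
  have hbound : ∀ᶠ T : ℕ in atTop,
      (∑ n ∈ Finset.range T, ∫ ω, N.weightedGap U φ y (p.auxQueue n ω) ∂(N.prob σ)) / T ≤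
      2 * D / N.τ / T + K * (N.τ / 4 * (N.Amax ^ 2 + R ^ 2)) +
        (∑ n ∈ Finset.range T, (N.prob σ).real (bindingSet p n)) / T * C := by
    filter_upwards [eventually_gt_atTop 0] with T hT
    have hT' : (0 : ℝ) < T := Nat.cast_pos.2 hT
    have h1 := Finset.sum_le_sum fun n (_ : n ∈ Finset.range T) => hdrift n
    rw [Finset.sum_add_distrib, Finset.sum_add_distrib, ← Finset.sum_div,
      Finset.sum_range_sub' L, Finset.sum_const, Finset.card_range, nsmul_eq_mul,
      ← Finset.sum_mul] at h1
    have h2 : (L 0 - L T) / N.τ ≤ 2 * D / N.τ := by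
      gcongr
      linarith [(abs_le.1 (hLD 0)).2, (abs_le.1 (hLD T)).1]
    simp only [hp.weightedGap_auxQueue hU hφ]
    rw [div_le_iff₀ hT']
    have e : (2 * D / N.τ / T + K * (N.τ / 4 * (N.Amax ^ 2 + R ^ 2)) +
        (∑ n ∈ Finset.range T, (N.prob σ).real (bindingSet p n)) / T * C) * T =
        2 * D / N.τ + T * (K * (N.τ / 4 * (N.Amax ^ 2 + R ^ 2))) +
        (∑ n ∈ Finset.range T, (N.prob σ).real (bindingSet p n)) * C := by
      field_simp
    rw [e]
    linarith
  have hrhs : Tendsto (fun T : ℕ => 2 * D / N.τ / T + K * (N.τ / 4 * (N.Amax ^ 2 + R ^ 2)) +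
      (∑ n ∈ Finset.range T, (N.prob σ).real (bindingSet p n)) / T * C) atTop
      (𝓝 (K * (N.τ / 4 * (N.Amax ^ 2 + R ^ 2)))) := by
    have hs : Tendsto (fun T : ℕ =>
        (∑ n ∈ Finset.range T, (N.prob σ).real (bindingSet p n)) / (T : ℝ)) atTop (𝓝 0) := hslack
    simpa using ((tendsto_const_div_atTop_nhds_zero_nat (2 * D / N.τ)).add_const
      (K * (N.τ / 4 * (N.Amax ^ 2 + R ^ 2)))).add (hs.mul_const C)
  exact le_of_tendsto_of_tendsto hlim hrhs hbound
end

/-- In slot `0` the auxiliary queues are empty and all flows are admitted at the maximum rate. -/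
theorem IsAlgorithmRun.sq_Amax_le [IsProbabilityMeasure σ] (hp : IsAlgorithmRun U φ σ p)
    (hU : ∀ k, UtilityOK (U k) ψ Ψ rbar) {A₁ : ℝ}
    (hA₁ : ∀ n k, ∫ ω, p.a n ω k ^ 2 ∂(N.prob σ) ≤ A₁) (k : Fin K) : N.Amax ^ 2 ≤ A₁ := by
  have h0 : ∀ ω, p.a 0 ω k = N.Amax := by
    intro ω
    rw [hp.congestion]
    refine (hU k).congestionRate_of_le N.Amax_pos.le ?_
    rw [show p.auxQueue 0 ω k = 0 from rfl, zero_div]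
    exact (hU k).marginal_nonneg _
  simpa [h0] using hA₁ 0 k

end Network

namespace Network

variable {K J : ℕ} {N : Network K J} {S₁ S₂ : Type} [MeasurableSpace S₁] [MeasurableSpace S₂]

/-! ### Randomization between two policies -/

/-- The sample seen by the first of two policies with a common random coin. -/
def leftSample (N : Network K J) (S₁ S₂ : Type) (ω : N.Sample (S₁ × S₂ × Bool)) : N.Sample S₁ :=
  (ω.1.1, ω.2)

/-- The sample seen by the second of two policies with a common random coin. -/
def rightSample (N : Network K J) (S₁ S₂ : Type) (ω : N.Sample (S₁ × S₂ × Bool)) : N.Sample S₂ :=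
  (ω.1.2.1, ω.2)

/-- The choice between two functions of the samples according to the coin. -/
def coinMix {X : Type*} (f₁ : N.Sample S₁ → X) (f₂ : N.Sample S₂ → X)
    (ω : N.Sample (S₁ × S₂ × Bool)) : X :=
  bif ω.1.2.2 then f₁ (N.leftSample S₁ S₂ ω) else f₂ (N.rightSample S₁ S₂ ω)

theorem measurable_leftSample_info (n : ℕ) :
    Measurable[N.info (S₁ × S₂ × Bool) n, N.info S₁ n] (N.leftSample S₁ S₂) := by
  rw [measurable_iff_le_map, info_le_iff]
  refine ⟨fun s hs => ?_, fun i hi s hs => ?_, fun t ht s hs => ?_⟩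
  · exact measurable_info_seed (N := N) (S := S₁ × S₂ × Bool) n (measurable_fst hs)
  · exact measurable_info_channel (N := N) (S := S₁ × S₂ × Bool) hi hs
  · exact measurable_info_arrival (N := N) (S := S₁ × S₂ × Bool) ht hs

theorem measurable_rightSample_info (n : ℕ) :
    Measurable[N.info (S₁ × S₂ × Bool) n, N.info S₂ n] (N.rightSample S₁ S₂) := by
  rw [measurable_iff_le_map, info_le_iff]
  refine ⟨fun s hs => ?_, fun i hi s hs => ?_, fun t ht s hs => ?_⟩
  · exact measurable_info_seed (N := N) (S := S₁ × S₂ × Bool) n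
      ((measurable_fst.comp measurable_snd) hs)
  · exact measurable_info_channel (N := N) (S := S₁ × S₂ × Bool) hi hs
  · exact measurable_info_arrival (N := N) (S := S₁ × S₂ × Bool) ht hs

theorem measurable_leftSample : Measurable (N.leftSample S₁ S₂) := by
  unfold leftSample
  fun_prop

theorem measurable_rightSample : Measurable (N.rightSample S₁ S₂) := by
  unfold rightSample
  fun_prop

theorem measurable_bif {Ω X : Type*} {m : MeasurableSpace Ω} [MeasurableSpace X] {c : Ω → Bool}
    (hc : Measurable c) {f g : Ω → X} (hf : Measurable f) (hg : Measurable g) :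
    Measurable fun ω => bif c ω then f ω else g ω := by
  have : (fun ω => bif c ω then f ω else g ω) = fun ω => if c ω = true then f ω else g ω := by
    funext ω
    cases c ω <;> rfl
  rw [this]
  exact Measurable.ite (hc (measurableSet_singleton true)) hf hg

/-- The coin is part of the seed, hence known from the start, so mixing preserves causality. -/
theorem measurable_coinMix_info {X : Type*} [MeasurableSpace X] {f₁ : N.Sample S₁ → X}
    {f₂ : N.Sample S₂ → X} {n : ℕ} (h₁ : Measurable[N.info S₁ n] f₁)
    (h₂ : Measurable[N.info S₂ n] f₂) :
    Measurable[N.info (S₁ × S₂ × Bool) n] (coinMix f₁ f₂) :=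
  measurable_bif ((measurable_snd.comp measurable_snd).comp
    (measurable_info_seed (N := N) (S := S₁ × S₂ × Bool) n))
    (h₁.comp (measurable_leftSample_info n)) (h₂.comp (measurable_rightSample_info n))

/-- Policy that follows `p₁` or `p₂` according to the coin. -/
def Policy.mix (p₁ : N.Policy S₁) (p₂ : N.Policy S₂) : N.Policy (S₁ × S₂ × Bool) where
  β t := coinMix (p₁.β t) (p₂.β t)
  a n := coinMix (p₁.a n) (p₂.a n)
  w n := coinMix (p₁.w n) (p₂.w n)
  β_meas t := measurable_coinMix_info (p₁.β_meas t) (p₂.β_meas t)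
  a_meas n := measurable_coinMix_info (p₁.a_meas n) (p₂.a_meas n)
  w_meas n := measurable_coinMix_info (p₁.w_meas n) (p₂.w_meas n)
  β_mem := by
    rintro t ⟨⟨s₁, s₂, c⟩, y⟩ k j
    cases c
    · exact p₂.β_mem t _ k j
    · exact p₁.β_mem t _ k j
  β_sum := by
    rintro t ⟨⟨s₁, s₂, c⟩, y⟩ k
    cases c
    · exact p₂.β_sum t _ k
    · exact p₁.β_sum t _ k
  a_mem := by
    rintro t ⟨⟨s₁, s₂, c⟩, y⟩ k
    cases c
    · exact p₂.a_mem t _ k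
    · exact p₁.a_mem t _ k
  w_mem := by
    rintro t ⟨⟨s₁, s₂, c⟩, y⟩
    cases c
    · exact p₂.w_mem t _
    · exact p₁.w_mem t _

theorem Policy.mix_a (p₁ : N.Policy S₁) (p₂ : N.Policy S₂) (n : ℕ)
    (ω : N.Sample (S₁ × S₂ × Bool)) (k : Fin K) :
    (p₁.mix p₂).a n ω k = coinMix (fun ω => p₁.a n ω k) (fun ω => p₂.a n ω k) ω := by
  obtain ⟨⟨s₁, s₂, c⟩, y⟩ := ω
  cases c <;> rfl

theorem Policy.mix_r (p₁ : N.Policy S₁) (p₂ : N.Policy S₂) (n : ℕ)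
    (ω : N.Sample (S₁ × S₂ × Bool)) (k : Fin K) :
    (p₁.mix p₂).r n ω k = coinMix (fun ω => p₁.r n ω k) (fun ω => p₂.r n ω k) ω := by
  obtain ⟨⟨s₁, s₂, c⟩, y⟩ := ω
  cases c <;> rfl

/-- The coin is tossed once for all time, so on each of its outcomes the whole trajectory is that of
a single policy. -/
theorem Policy.mix_queue (p₁ : N.Policy S₁) (p₂ : N.Policy S₂) (n : ℕ)
    (ω : N.Sample (S₁ × S₂ × Bool)) :
    (p₁.mix p₂).queue n ω = coinMix (p₁.queue n) (p₂.queue n) ω := by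
  obtain ⟨⟨s₁, s₂, c⟩, y⟩ := ω
  induction n with
  | zero => cases c <;> rfl
  | succ n ih =>
    funext k j
    have h := congrFun (congrFun ih k) j
    cases c
    · exact congrArg (fun x => max 0 (x + p₂.β (n / N.Tf) (s₂, y) k j * y.2 (n / N.Tf) k * N.τ
        - N.pathRate (y.1 n) (p₂.w n (s₂, y)) k j * N.τ)) h
    · exact congrArg (fun x => max 0 (x + p₁.β (n / N.Tf) (s₁, y) k j * y.2 (n / N.Tf) k * N.τ
        - N.pathRate (y.1 n) (p₁.w n (s₁, y)) k j * N.τ)) h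

theorem Policy.mix_delayOK (p₁ : N.Policy S₁) (p₂ : N.Policy S₂) (n : ℕ)
    (ω : N.Sample (S₁ × S₂ × Bool)) :
    (p₁.mix p₂).DelayOK n ω ((p₁.mix p₂).w n ω) ↔
      coinMix (fun ω => p₁.DelayOK n ω (p₁.w n ω)) (fun ω => p₂.DelayOK n ω (p₂.w n ω)) ω := by
  obtain ⟨⟨s₁, s₂, c⟩, y⟩ := ω
  cases c <;> exact Iff.rfl

/-- Law of the seeds of two policies and of a coin with success probability `1 - θ`. -/
def mixSeed (σ₁ : Measure S₁) (σ₂ : Measure S₂) (θ : ℝ) : Measure (S₁ × S₂ × Bool) :=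
  ENNReal.ofReal (1 - θ) • σ₁.prod (σ₂.prod (Measure.dirac true)) +
    ENNReal.ofReal θ • σ₁.prod (σ₂.prod (Measure.dirac false))

section
variable (σ₁ : Measure S₁) (σ₂ : Measure S₂) [IsProbabilityMeasure σ₁] [IsProbabilityMeasure σ₂]
  {θ : ℝ}

theorem isProbabilityMeasure_mixSeed (hθ : θ ∈ Set.Icc (0 : ℝ) 1) :
    IsProbabilityMeasure (mixSeed σ₁ σ₂ θ) := by
  refine ⟨?_⟩
  simp only [mixSeed, Measure.add_apply, Measure.smul_apply, measure_univ, smul_eq_mul, mul_one]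
  rw [← ENNReal.ofReal_add (by linarith [hθ.2]) hθ.1]
  simp

theorem prob_mixSeed :
    N.prob (mixSeed σ₁ σ₂ θ) =
      ENNReal.ofReal (1 - θ) • N.prob (σ₁.prod (σ₂.prod (Measure.dirac true))) +
        ENNReal.ofReal θ • N.prob (σ₁.prod (σ₂.prod (Measure.dirac false))) := by
  have := N.chan_prob
  have := N.arr_prob
  have : IsFiniteMeasure (ENNReal.ofReal (1 - θ) • σ₁.prod (σ₂.prod (Measure.dirac true))) :=
    Measure.smul_finite _ ENNReal.ofReal_ne_top
  have : IsFiniteMeasure (ENNReal.ofReal θ • σ₁.prod (σ₂.prod (Measure.dirac false))) :=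
    Measure.smul_finite _ ENNReal.ofReal_ne_top
  unfold prob mixSeed
  rw [Measure.add_prod, Measure.prod_smul_left, Measure.prod_smul_left]

theorem measurePreserving_leftSample (c : Bool) :
    MeasurePreserving (N.leftSample S₁ S₂) (N.prob (σ₁.prod (σ₂.prod (Measure.dirac c))))
      (N.prob σ₁) := by
  have := N.chan_prob
  have := N.arr_prob
  exact (measurePreserving_fst (μ := σ₁) (ν := σ₂.prod (Measure.dirac c))).prod
    (MeasurePreserving.id ((Measure.infinitePi fun _ : ℕ => N.chan).prod N.arr))

theorem measurePreserving_rightSample (c : Bool) :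
    MeasurePreserving (N.rightSample S₁ S₂) (N.prob (σ₁.prod (σ₂.prod (Measure.dirac c))))
      (N.prob σ₂) := by
  have := N.chan_prob
  have := N.arr_prob
  exact ((measurePreserving_fst (μ := σ₂) (ν := Measure.dirac c)).comp
    (measurePreserving_snd (μ := σ₁) (ν := σ₂.prod (Measure.dirac c)))).prod
    (MeasurePreserving.id ((Measure.infinitePi fun _ : ℕ => N.chan).prod N.arr))

theorem ae_coin (c : Bool) :
    ∀ᵐ ω ∂(N.prob (σ₁.prod (σ₂.prod (Measure.dirac c)))), ω.1.2.2 = c := by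
  have := N.chan_prob
  have := N.arr_prob
  have h : MeasurePreserving (fun ω : N.Sample (S₁ × S₂ × Bool) => ω.1.2.2)
      (N.prob (σ₁.prod (σ₂.prod (Measure.dirac c)))) (Measure.dirac c) :=
    ((measurePreserving_snd (μ := σ₂) (ν := Measure.dirac c)).comp
      (measurePreserving_snd (μ := σ₁) (ν := σ₂.prod (Measure.dirac c)))).comp
      (measurePreserving_fst (μ := σ₁.prod (σ₂.prod (Measure.dirac c)))
        (ν := (Measure.infinitePi fun _ : ℕ => N.chan).prod N.arr))
  exact h.quasiMeasurePreserving.ae (p := fun b => b = c) (by simp [ae_dirac_eq])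

theorem ae_coinMix {P₁ : N.Sample S₁ → Prop} {P₂ : N.Sample S₂ → Prop}
    (h₁ : ∀ᵐ ω ∂(N.prob σ₁), P₁ ω) (h₂ : ∀ᵐ ω ∂(N.prob σ₂), P₂ ω) :
    ∀ᵐ ω ∂(N.prob (mixSeed σ₁ σ₂ θ)), coinMix P₁ P₂ ω := by
  rw [prob_mixSeed, ae_add_measure_iff]
  constructor
  · refine Measure.ae_smul_measure ?_ _
    filter_upwards [ae_coin σ₁ σ₂ true,
      (measurePreserving_leftSample σ₁ σ₂ true).quasiMeasurePreserving.ae h₁] with ω hc h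
    rw [coinMix, hc]
    exact h
  · refine Measure.ae_smul_measure ?_ _
    filter_upwards [ae_coin σ₁ σ₂ false,
      (measurePreserving_rightSample σ₁ σ₂ false).quasiMeasurePreserving.ae h₂] with ω hc h
    rw [coinMix, hc]
    exact h

theorem lintegral_coinMix {f₁ : N.Sample S₁ → ENNReal} {f₂ : N.Sample S₂ → ENNReal}
    (h₁ : Measurable f₁) (h₂ : Measurable f₂) :
    ∫⁻ ω, coinMix f₁ f₂ ω ∂(N.prob (mixSeed σ₁ σ₂ θ)) =
      ENNReal.ofReal (1 - θ) * ∫⁻ ω, f₁ ω ∂(N.prob σ₁) +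
        ENNReal.ofReal θ * ∫⁻ ω, f₂ ω ∂(N.prob σ₂) := by
  rw [prob_mixSeed, lintegral_add_measure, lintegral_smul_measure, lintegral_smul_measure,
    ← (measurePreserving_leftSample σ₁ σ₂ true).lintegral_comp h₁,
    ← (measurePreserving_rightSample σ₁ σ₂ false).lintegral_comp h₂, smul_eq_mul, smul_eq_mul]
  congr 2
  · refine lintegral_congr_ae ?_
    filter_upwards [ae_coin σ₁ σ₂ true] with ω hc
    rw [coinMix, hc]
    rfl
  · refine lintegral_congr_ae ?_
    filter_upwards [ae_coin σ₁ σ₂ false] with ω hc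
    rw [coinMix, hc]
    rfl

theorem integral_coinMix (hθ : θ ∈ Set.Icc (0 : ℝ) 1) {f₁ : N.Sample S₁ → ℝ}
    {f₂ : N.Sample S₂ → ℝ} (h₁ : Integrable f₁ (N.prob σ₁)) (h₂ : Integrable f₂ (N.prob σ₂)) :
    ∫ ω, coinMix f₁ f₂ ω ∂(N.prob (mixSeed σ₁ σ₂ θ)) =
      (1 - θ) * ∫ ω, f₁ ω ∂(N.prob σ₁) + θ * ∫ ω, f₂ ω ∂(N.prob σ₂) := by
  have m₁ := measurePreserving_leftSample (N := N) σ₁ σ₂ true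
  have m₂ := measurePreserving_rightSample (N := N) σ₁ σ₂ false
  have c₁ : (fun ω => f₁ (N.leftSample S₁ S₂ ω)) =ᵐ[N.prob (σ₁.prod (σ₂.prod
      (Measure.dirac true)))] coinMix f₁ f₂ := by
    filter_upwards [ae_coin σ₁ σ₂ true] with ω hc
    rw [coinMix, hc]
    rfl
  have c₂ : (fun ω => f₂ (N.rightSample S₁ S₂ ω)) =ᵐ[N.prob (σ₁.prod (σ₂.prod
      (Measure.dirac false)))] coinMix f₁ f₂ := by
    filter_upwards [ae_coin σ₁ σ₂ false] with ω hc
    rw [coinMix, hc]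
    rfl
  have e₁ : ∫ ω, f₁ ω ∂(N.prob σ₁) =
      ∫ ω, f₁ (N.leftSample S₁ S₂ ω) ∂(N.prob (σ₁.prod (σ₂.prod (Measure.dirac true)))) := by
    rw [← m₁.map_eq, integral_map m₁.measurable.aemeasurable]
    rw [m₁.map_eq]
    exact h₁.aestronglyMeasurable
  have e₂ : ∫ ω, f₂ ω ∂(N.prob σ₂) =
      ∫ ω, f₂ (N.rightSample S₁ S₂ ω) ∂(N.prob (σ₁.prod (σ₂.prod (Measure.dirac false)))) := by
    rw [← m₂.map_eq, integral_map m₂.measurable.aemeasurable]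
    rw [m₂.map_eq]
    exact h₂.aestronglyMeasurable
  have i₁ := (m₁.integrable_comp_of_integrable h₁).congr c₁
  have i₂ := (m₂.integrable_comp_of_integrable h₂).congr c₂
  rw [prob_mixSeed, integral_add_measure (i₁.smul_measure ENNReal.ofReal_ne_top)
    (i₂.smul_measure ENNReal.ofReal_ne_top), integral_smul_measure, integral_smul_measure,
    ENNReal.toReal_ofReal (by linarith [hθ.2]), ENNReal.toReal_ofReal hθ.1, e₁, e₂,
    integral_congr_ae c₁, integral_congr_ae c₂, smul_eq_mul, smul_eq_mul]

end

theorem limsup_lt_top_iff {u : ℕ → ENNReal} :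
    limsup u atTop < ⊤ ↔ ∃ C : ENNReal, C < ⊤ ∧ ∀ᶠ n in atTop, u n ≤ C := by
  constructor
  · intro h
    obtain ⟨C, h1, h2⟩ := exists_between h
    exact ⟨C, h2, (eventually_lt_of_limsup_lt h1).mono fun _ hn => hn.le⟩
  · rintro ⟨C, hC, h⟩
    exact (limsup_le_of_le (h := h)).trans_lt hC

variable {R : ℝ}

/-- The feasible average rates form a convex set, by randomization. -/
theorem mix_mem_feasibleRates (hR0 : 0 ≤ R)
    (hR : ∀ᵐ h ∂N.chan, ∀ w ∈ N.powerSet, ∀ k, N.rate h w k ≤ R) {x y : Fin K → ℝ}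
    (hx : x ∈ N.feasibleRates) (hy : y ∈ N.feasibleRates) {θ : ℝ} (hθ : θ ∈ Set.Icc (0 : ℝ) 1) :
    (fun k => (1 - θ) * x k + θ * y k) ∈ N.feasibleRates := by
  obtain ⟨S₁, _, σ₁, _, p₁, h₁⟩ := hx
  obtain ⟨S₂, _, σ₂, _, p₂, h₂⟩ := hy
  have hθ' : 0 ≤ 1 - θ := by linarith [hθ.2]
  have hprob := isProbabilityMeasure_mixSeed σ₁ σ₂ hθ
  refine ⟨S₁ × S₂ × Bool, inferInstance, mixSeed σ₁ σ₂ θ, hprob, p₁.mix p₂, ?_⟩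
  have hr : ∀ (k : Fin K) (T : ℕ), (∑ n ∈ Finset.range T,
      ∫ ω, (p₁.mix p₂).r n ω k ∂(N.prob (mixSeed σ₁ σ₂ θ))) / T =
      (1 - θ) * ((∑ n ∈ Finset.range T, ∫ ω, p₁.r n ω k ∂(N.prob σ₁)) / T) +
        θ * ((∑ n ∈ Finset.range T, ∫ ω, p₂.r n ω k ∂(N.prob σ₂)) / T) := by
    intro k T
    simp only [Policy.mix_r, integral_coinMix σ₁ σ₂ hθ (p₁.integrable_r σ₁ hR _ k)
      (p₂.integrable_r σ₂ hR _ k), Finset.sum_add_distrib, ← Finset.mul_sum]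
    ring
  refine ⟨fun k => ?_, ?_, fun n => ?_, fun k => ?_⟩
  · have ha : ∀ T : ℕ, (∑ n ∈ Finset.range T,
        ∫ ω, (p₁.mix p₂).a n ω k ∂(N.prob (mixSeed σ₁ σ₂ θ))) / T =
        (1 - θ) * ((∑ n ∈ Finset.range T, ∫ ω, p₁.a n ω k ∂(N.prob σ₁)) / T) +
          θ * ((∑ n ∈ Finset.range T, ∫ ω, p₂.a n ω k ∂(N.prob σ₂)) / T) := by
      intro T
      simp only [Policy.mix_a, integral_coinMix σ₁ σ₂ hθ (p₁.integrable_a σ₁ _ k)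
        (p₂.integrable_a σ₂ _ k), Finset.sum_add_distrib, ← Finset.mul_sum]
      ring
    simp only [ha]
    exact ((h₁.avg k).const_mul (1 - θ)).add ((h₂.avg k).const_mul θ)
  · obtain ⟨C₁, hC₁, e₁⟩ := limsup_lt_top_iff.1 h₁.stable
    obtain ⟨C₂, hC₂, e₂⟩ := limsup_lt_top_iff.1 h₂.stable
    refine limsup_lt_top_iff.2 ⟨ENNReal.ofReal (1 - θ) * C₁ + ENNReal.ofReal θ * C₂, ?_, ?_⟩
    · exact ENNReal.add_lt_top.2 ⟨ENNReal.mul_lt_top ENNReal.ofReal_lt_top hC₁,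
        ENNReal.mul_lt_top ENNReal.ofReal_lt_top hC₂⟩
    · filter_upwards [e₁, e₂] with n g₁ g₂
      have m₁ : Measurable fun ω => ENNReal.ofReal (∑ k, ∑ j, p₁.queue n ω k j) :=
        (Finset.measurable_fun_sum _ fun k _ => Finset.measurable_fun_sum _ fun j _ =>
          p₁.measurable_queue n k j).ennreal_ofReal
      have m₂ : Measurable fun ω => ENNReal.ofReal (∑ k, ∑ j, p₂.queue n ω k j) :=
        (Finset.measurable_fun_sum _ fun k _ => Finset.measurable_fun_sum _ fun j _ =>
          p₂.measurable_queue n k j).ennreal_ofReal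
      have e : ∀ ω, ENNReal.ofReal (∑ k, ∑ j, (p₁.mix p₂).queue n ω k j) =
          coinMix (fun ω => ENNReal.ofReal (∑ k, ∑ j, p₁.queue n ω k j))
            (fun ω => ENNReal.ofReal (∑ k, ∑ j, p₂.queue n ω k j)) ω := by
        intro ω
        rw [Policy.mix_queue]
        obtain ⟨⟨s₁, s₂, c⟩, y⟩ := ω
        cases c <;> rfl
      simp only [e]
      rw [lintegral_coinMix σ₁ σ₂ m₁ m₂]
      gcongr
  · filter_upwards [ae_coinMix (θ := θ) σ₁ σ₂ (h₁.delay n) (h₂.delay n)] with ω hω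
    exact (p₁.mix_delayOK p₂ n ω).2 hω
  -- The two rate averages need not converge, so their liminfs are combined through eventual lower
  -- bounds.
  · refine le_of_forall_pos_le_add fun ε hε => ?_
    have l₁ := eventually_lt_of_lt_liminf ((sub_lt_self _ hε).trans_le (h₁.le_rate k))
      (p₁.isBoundedUnder_average_r σ₁ k)
    have l₂ := eventually_lt_of_lt_liminf ((sub_lt_self _ hε).trans_le (h₂.le_rate k))
      (p₂.isBoundedUnder_average_r σ₂ k)
    rw [← sub_le_iff_le_add]
    refine le_liminf_of_le ((p₁.mix p₂).isCoboundedUnder_average_r _ hR hR0 k) ?_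
    filter_upwards [l₁, l₂] with T g₁ g₂
    rw [hr]
    have := mul_le_mul_of_nonneg_left g₁.le hθ'
    have := mul_le_mul_of_nonneg_left g₂.le hθ.1
    linarith

end Network

namespace Network

variable {K J : ℕ} {N : Network K J} {S : Type} [MeasurableSpace S]
  {U : Fin K → ℝ → ℝ} {ψ Ψ rbar φ R : ℝ} {σ : Measure S} {p : N.Policy S}

/-! ### Optimality -/

/-- First-order optimality condition over the convex set of feasible rates. -/
theorem sum_marginal_mul_nonpos (hU : ∀ k, UtilityOK (U k) ψ Ψ rbar) (hR0 : 0 ≤ R)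
    (hR : ∀ᵐ h ∂N.chan, ∀ w ∈ N.powerSet, ∀ k, N.rate h w k ≤ R) {x y : Fin K → ℝ}
    (hx : x ∈ N.feasibleRates) (hopt : IsMaxOn (totalUtility U) N.feasibleRates x)
    (hy : y ∈ N.feasibleRates) : ∑ k, marginal (U k) (x k) * (y k - x k) ≤ 0 := by
  have hx0 : ∀ k, 0 ≤ x k := fun k => (mem_Icc_of_feasibleRates hx k).1
  have hy0 : ∀ k, 0 ≤ y k := fun k => (mem_Icc_of_feasibleRates hy k).1
  let z : ℝ → Fin K → ℝ := fun θ k => (1 - θ) * x k + θ * y k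
  have hz0 : ∀ θ ∈ Set.Icc (0 : ℝ) 1, ∀ k, 0 ≤ z θ k := fun θ hθ k =>
    add_nonneg (mul_nonneg (by linarith [hθ.2]) (hx0 k)) (mul_nonneg hθ.1 (hy0 k))
  have hle : ∀ θ ∈ Set.Ioc (0 : ℝ) 1, ∑ k, marginal (U k) (z θ k) * (y k - x k) ≤ 0 := by
    intro θ hθ
    have hθ' : θ ∈ Set.Icc (0 : ℝ) 1 := ⟨hθ.1.le, hθ.2⟩
    have h1 : totalUtility U (z θ) ≤ totalUtility U x :=
      isMaxOn_iff.1 hopt _ (mix_mem_feasibleRates hR0 hR hx hy hθ')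
    -- The tangent is taken at the mixture, not at `x`: optimality then gives the sign for every `θ
    -- > 0`, and continuity of `U'` carries it to `θ = 0`.
    have h2 : totalUtility U x ≤ totalUtility U (z θ) +
        ∑ k, marginal (U k) (z θ k) * (x k - z θ k) := by
      unfold totalUtility
      rw [← Finset.sum_add_distrib]
      exact Finset.sum_le_sum fun k _ => (hU k).le_tangent (hx0 k) (hz0 θ hθ' k)
    have h3 : ∑ k, marginal (U k) (z θ k) * (x k - z θ k) =
        -θ * ∑ k, marginal (U k) (z θ k) * (y k - x k) := by
      rw [Finset.mul_sum]
      exact Finset.sum_congr rfl fun k _ => by simp only [z]; ring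
    have h4 : 0 ≤ θ * -∑ k, marginal (U k) (z θ k) * (y k - x k) := by linarith
    linarith [nonneg_of_mul_nonneg_right h4 hθ.1]
  have hlim : Tendsto (fun θ => ∑ k, marginal (U k) (z θ k) * (y k - x k)) (𝓝[>] 0)
      (𝓝 (∑ k, marginal (U k) (x k) * (y k - x k))) := by
    refine tendsto_finsetSum _ fun k _ => Tendsto.mul_const _ ?_
    refine ((hU k).continuousOn_marginal (x k) (hx0 k)).tendsto.comp ?_
    refine tendsto_nhdsWithin_iff.2 ⟨?_, ?_⟩
    · have hc : Continuous fun θ : ℝ => z θ k := by fun_prop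
      have := hc.tendsto 0
      simp only [z, sub_zero, one_mul, zero_mul, add_zero] at this
      exact this.mono_left nhdsWithin_le_nhds
    · filter_upwards [Ioc_mem_nhdsGT one_pos] with θ hθ using hz0 θ ⟨hθ.1.le, hθ.2⟩ k
  refine le_of_tendsto hlim ?_
  filter_upwards [Ioc_mem_nhdsGT one_pos] with θ hθ using hle θ hθ

/-- Affine lower bounds on the first-order utility gaps transfer to the mean rate. -/
theorem IsAlgorithmRun.sum_affine_le [IsProbabilityMeasure σ] (hp : IsAlgorithmRun U φ σ p)
    (hU : ∀ k, UtilityOK (U k) ψ Ψ rbar) (hφ : 0 < φ) (hR0 : 0 ≤ R)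
    (hR : ∀ᵐ h ∂N.chan, ∀ w ∈ N.powerSet, ∀ k, N.rate h w k ≤ R) (hslack : DelaySlack σ p)
    {ρ : Measure (Fin K → ℝ)} (hρ : IsSteadyState σ p ρ) {x : Fin K → ℝ}
    (hx : x ∈ N.feasibleRates) {α β : Fin K → ℝ}
    (hαβ : ∀ k, ∀ c ∈ Set.Icc 0 N.Amax, α k + β k * c ≤ marginal (U k) c * (x k - c)) :
    ∑ k, (α k + β k * N.meanRate U φ ρ k) ≤ K * (N.Amax ^ 2 + R ^ 2) / (4 * φ) := by
  have := hρ.1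
  have hτ := N.τ_pos
  have hφτ : 0 < φ * N.τ := mul_pos hφ hτ
  have hx' := mem_Icc_of_feasibleRates hx
  have hpt : ∀ q : Fin K → ℝ,
      ∑ k, (α k + β k * congestionRate (U k) N.Amax (q k / (φ * N.τ))) ≤
        N.weightedGap U φ x q / (φ * N.τ) := by
    intro q
    unfold weightedGap
    rw [Finset.sum_div]
    refine Finset.sum_le_sum fun k _ => ?_
    refine (hαβ k _ ((hU k).congestionRate_mem N.Amax_pos.le _)).trans ?_
    have hb : marginal (U k) 0 * (φ * N.τ) ≤ N.queueBound (U k) φ :=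
      le_add_of_nonneg_right (mul_nonneg N.Amax_pos.le hτ.le)
    -- The clipped queue serves as the price; clipping does not change the admitted rate.
    have h1 := (hU k).marginal_mul_le N.Amax_pos.le
      (max 0 (min (q k) (N.queueBound (U k) φ)) / (φ * N.τ)) (hx' k)
    rw [(hU k).congestionRate_clip N.Amax_pos.le hφτ hb] at h1
    rwa [div_mul_eq_mul_div] at h1
  have hint : ∀ k ∈ Finset.univ, Integrable (fun q : Fin K → ℝ =>
      α k + β k * congestionRate (U k) N.Amax (q k / (φ * N.τ))) ρ := fun k _ =>
    (integrable_const _).add ((integrable_congestionRate hU k).const_mul _)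
  have hgap : Integrable (N.weightedGap U φ x) ρ :=
    integrable_of_measurable_of_abs_le (continuous_weightedGap hU x).measurable
      (abs_weightedGap_le hU hφ hx')
  have h1 := integral_mono (integrable_finsetSum _ hint) (hgap.div_const (φ * N.τ)) hpt
  rw [integral_finsetSum _ hint, integral_div] at h1
  have h2 : ∀ k, ∫ q, (α k + β k * congestionRate (U k) N.Amax (q k / (φ * N.τ))) ∂ρ =
      α k + β k * N.meanRate U φ ρ k := by
    intro k
    rw [integral_add (integrable_const _) ((integrable_congestionRate hU k).const_mul _),
      integral_const_mul, integral_const]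
    simp [meanRate]
  simp only [h2] at h1
  refine h1.trans ?_
  calc (∫ q, N.weightedGap U φ x q ∂ρ) / (φ * N.τ)
      ≤ K * (N.τ / 4 * (N.Amax ^ 2 + R ^ 2)) / (φ * N.τ) :=
        div_le_div_of_nonneg_right (hp.integral_weightedGap_le hU hφ hR0 hR hslack hρ hx) hφτ.le
    _ = K * (N.Amax ^ 2 + R ^ 2) / (4 * φ) := by field_simp

end Network

end

theorem theorem2 {K J : ℕ} (N : Network K J)
    (U : Fin K → ℝ → ℝ) (ψ Ψ : ℝ) (hψ : 0 < ψ) (hψΨ : ψ ≤ Ψ)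
    (hU : ∀ k, UtilityOK (U k) ψ Ψ N.maxAvgRate)
    (rmax : ℝ) (hrmax_pos : 0 < rmax)
    (hrmax : ∀ᵐ h ∂N.chan, ∀ w ∈ N.powerSet, ∀ k, N.rate h w k ≤ rmax)
    (φ : ℝ) (hφ : 0 < φ)
    {S : Type} [MeasurableSpace S] (σ : Measure S) [IsProbabilityMeasure σ]
    (p : N.Policy S) (hp : Network.IsAlgorithmRun U φ σ p)
    (A₁ : ℝ) (hA₁ : ∀ n k, ∫ ω, p.a n ω k ^ 2 ∂(N.prob σ) ≤ A₁)
    (hstable : p.Stable σ) (hslack : Network.DelaySlack σ p)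
    (ρ : Measure (Fin K → ℝ)) (hρ : Network.IsSteadyState σ p ρ)
    (aStar : Fin K → ℝ) (haStar : aStar ∈ N.feasibleRates)
    (hopt : IsMaxOn (totalUtility U) N.feasibleRates aStar) :
    ‖WithLp.toLp 2 (N.meanRate U φ ρ) - WithLp.toLp 2 aStar‖ ≤ N.C₂ ψ Ψ A₁ rmax * (1 / √φ) ∧
      totalUtility U aStar - N.C₃ ψ Ψ A₁ rmax * (1 / φ) ≤ totalUtility U (N.meanRate U φ ρ) := by
  have hτ := N.τ_pos
  have hΨ : 0 < Ψ := hψ.trans_le hψΨ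
  set z := N.meanRate U φ ρ with hz
  have hzf : z ∈ N.feasibleRates :=
    ⟨S, inferInstance, σ, inferInstance, p, hp.feasible hU hφ hrmax hstable hρ⟩
  have hx0 : ∀ k, aStar k ∈ Set.Icc 0 N.maxAvgRate := fun k =>
    ⟨(Network.mem_Icc_of_feasibleRates haStar k).1,
      Network.le_maxAvgRate hrmax hrmax_pos.le haStar k⟩
  have hz0 : ∀ k, z k ∈ Set.Icc 0 N.maxAvgRate := fun k =>
    ⟨(Network.mem_Icc_of_feasibleRates hzf k).1,
      Network.le_maxAvgRate hrmax hrmax_pos.le hzf k⟩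
  set D : ℝ := K * (A₁ + rmax ^ 2) / (4 * φ) with hD
  -- `A₁` is constrained only if some flow exists, hence the separate case `K = 0`.
  have hKA : (K : ℝ) * (N.Amax ^ 2 + rmax ^ 2) ≤ K * (A₁ + rmax ^ 2) := by
    rcases Nat.eq_zero_or_pos K with h | h
    · subst h; simp
    · have := hp.sq_Amax_le hU hA₁ ⟨0, h⟩
      gcongr
  have hK0 : 0 ≤ (K : ℝ) * (A₁ + rmax ^ 2) := le_trans (by positivity) hKA
  have hAD : K * (N.Amax ^ 2 + rmax ^ 2) / (4 * φ) ≤ D :=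
    div_le_div_of_nonneg_right hKA (by positivity)
  have hD0 : 0 ≤ D := div_nonneg hK0 (by positivity)
  have hC1 : N.C₁ Ψ A₁ rmax ^ 2 = 2 * N.τ ^ 2 * Ψ * φ * D := by
    rw [Network.C₁, Real.sq_sqrt]
    · rw [hD]; field_simp; ring
    · have : 0 ≤ N.τ ^ 2 * Ψ / 2 * (K * (A₁ + rmax ^ 2)) := by positivity
      linarith
  constructor
  -- `α + β c` is `U'(x)(x - c)` plus the affine minorant, expanded in powers of `c`.
  · have h1 := hp.sum_affine_le hU hφ hrmax_pos.le hrmax hslack hρ haStar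
      (α := fun k => marginal (U k) (aStar k) * aStar k -
        ψ * ((z k - aStar k) * aStar k + (z k - aStar k) ^ 2 / 4))
      (β := fun k => ψ * (z k - aStar k) - marginal (U k) (aStar k)) (by
        intro k c hc
        have := (hU k).affine_le_marginal_gap hψ (hx0 k) (hz0 k) hc.1
        linarith)
    have h2 := Network.sum_marginal_mul_nonpos hU hrmax_pos.le hrmax haStar hopt hzf
    have h3 : ∑ k, ((marginal (U k) (aStar k) * aStar k -
        ψ * ((z k - aStar k) * aStar k + (z k - aStar k) ^ 2 / 4)) +
        (ψ * (z k - aStar k) - marginal (U k) (aStar k)) * z k) =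
        3 / 4 * ψ * ∑ k, (z k - aStar k) ^ 2 -
          ∑ k, marginal (U k) (aStar k) * (z k - aStar k) := by
      rw [Finset.mul_sum, ← Finset.sum_sub_distrib]
      exact Finset.sum_congr rfl fun k _ => by ring
    have h4 : 3 / 4 * ψ * ∑ k, (z k - aStar k) ^ 2 ≤ D := by
      rw [← hz] at h1
      linarith
    have hC2 : (N.C₂ ψ Ψ A₁ rmax * (1 / √φ)) ^ 2 = 2 * Ψ * D / ψ ^ 2 := by
      rw [mul_pow, Network.C₂, div_pow, hC1, div_pow, Real.sq_sqrt hφ.le]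
      field_simp
    rw [← WithLp.toLp_sub, EuclideanSpace.norm_eq, Real.sqrt_le_iff]
    refine ⟨?_, ?_⟩
    · unfold Network.C₂ Network.C₁
      positivity
    · rw [hC2, le_div_iff₀ (by positivity)]
      simp only [Pi.sub_apply, Real.norm_eq_abs, sq_abs]
      -- It remains that `(4/3) ψ D ≤ 2 Ψ D`.
      have h5 : ψ * D ≤ Ψ * D := mul_le_mul_of_nonneg_right hψΨ hD0
      have h6 := mul_le_mul_of_nonneg_left h4 hψ.le
      have h7 : 0 ≤ ψ * D := mul_nonneg hψ.le hD0
      linarith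
  -- `α + β c` is `U x` minus the tangent of `U` at `z`, evaluated at `c`. It lies below `U x - U
  -- c`, hence below `U'(c)(x - c)`.
  · have h1 := hp.sum_affine_le hU hφ hrmax_pos.le hrmax hslack hρ haStar
      (α := fun k => U k (aStar k) - U k (z k) + marginal (U k) (z k) * z k)
      (β := fun k => -marginal (U k) (z k)) (by
        intro k c hc
        have := (hU k).le_tangent (hx0 k).1 hc.1
        have := (hU k).le_tangent hc.1 (hz0 k).1
        linarith)
    have h2 : ∑ k, ((U k (aStar k) - U k (z k) + marginal (U k) (z k) * z k) +
        -marginal (U k) (z k) * z k) = totalUtility U aStar - totalUtility U z := by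
      unfold totalUtility
      rw [← Finset.sum_sub_distrib]
      exact Finset.sum_congr rfl fun k _ => by ring
    have hC3 : N.C₃ ψ Ψ A₁ rmax * (1 / φ) = Ψ ^ 2 / ψ ^ 2 * D := by
      rw [Network.C₃, hC1]
      field_simp
    have h3 : 1 ≤ Ψ ^ 2 / ψ ^ 2 := by
      rw [one_le_div (by positivity)]
      gcongr
    have h4 := le_mul_of_one_le_left hD0 h3
    rw [← hz] at h1
    linarith
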